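/- Let $\mathbb T$ be the unit circle with angular variable $\theta\in\mathbb R/2\pi\mathbb Z$, let $\Omega=\mathbb T\times(0,1)$ with points $z=(\theta,r)$ and $dz=d\theta\,dr$, let $\Gamma^*=\mathbb T\times\{0\}$ and $\Gamma=\mathbb T\times\{1\}$, and let $\nu$ be the outward unit normal, so $\nu=(0,-1)$ on $\Gamma^*$. Let $\alpha\in[1,2)$, $w=r^\alpha$ and $A=\operatorname{diag}(1,w)$. All functions are real-valued, and $\nabla=(\partial_\theta,\partial_r)$ and $\operatorname{div}$ are understood in the sense of distributions on $\Omega$. Define $$H(\operatorname{div},\Omega)=\{\mathbf u\in L^2(\Omega)^2:\operatorname{div}\mathbf u\in L^2(\Omega)\},\qquad \|\mathbf u\|^2=\int_\Omega\big(|\mathbf u|^2+(\operatorname{div}\mathbf u)^2\big)\,dz,$$ $$H(\operatorname{div},\Omega;w^{-1})=\Big\{\mathbf u\in H(\operatorname{div},\Omega):\int_\Omega \mathbf u\cdot A^{-1}\mathbf u\,dz<\infty\Big\},$$ $$H^1(\Omega;w)=\Big\{u\in L^2(\Omega):\int_\Omega\nabla u\cdot A\nabla u\,dz<\infty\Big\},\qquad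 \|u\|^2=\int_\Omega\big(\nabla u\cdot A\nabla u+u^2\big)\,dz,$$ $$H^2(\Omega;w)=\{u\in H^1(\Omega;w):\operatorname{div}(A\nabla u)\in L^2(\Omega)\},$$ and let $H^1_\Gamma(\Omega;w)$ be the closure in $H^1(\Omega;w)$ of the functions in $C^\infty(\overline\Omega)$ whose support has positive distance to $\Gamma$. Identify $\Gamma^*$ with $\mathbb T$; let $H^{1/2}(\Gamma^*)$ be the space of $v\in L^2(\mathbb T)$ with $\sum_{n\in\mathbb Z}|n||\hat v(n)|^2<\infty$, normed by $\big(\|v\|_{L^2}^2+\sum_n|n||\hat v(n)|^2\big)^{1/2}$, and let $H^{-1/2}(\Gamma^*)$ be its dual space. The normal trace $\gamma_\nu:H(\operatorname{div},\Omega)\to H^{-1/2}(\Gamma^*)$ is the extension by continuity of the map given on $\mathbf u=(u_1,u_2)\in[C^\infty(\overline\Omega)]^2$ by $\gamma_\nu\mathbf u=\mathbf u\cdot\nu=-u_2$ on $\Gamma^*$, that is, $\langle\gamma_\nu\mathbf u,v\rangle=-\int_{\mathbb T}u_2(\theta,0)v(\theta)\,d\theta$. **Theorem 2.17.** The normal trace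 $\gamma_\nu$ is well defined: it is the unique bounded linear operator $H(\operatorname{div},\Omega)\to H^{-1/2}(\Gamma^*)$ with these values on $[C^\infty(\overline\Omega)]^2$. Moreover: (i) $H(\operatorname{div},\Omega;w^{-1})\subseteq\ker\gamma_\nu=\{\mathbf u\in H(\operatorname{div},\Omega):\gamma_\nu\mathbf u=0\}$. (ii) For every $u\in H^2(\Omega;w)$ one has $\dfrac{\partial u}{\partial\nu_A}:=\gamma_\nu(A\nabla u)=0$ on $\Gamma^*$. Furthermore, for all $u\in H^2(\Omega;w)$ and $v\in H^1_\Gamma(\Omega;w)$, $$-\int_\Omega[\operatorname{div}(A\nabla u)]\,v\,dz=\int_\Omega\nabla v\cdot A\nabla u\,dz .$$ -/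

import Mathlib

open MeasureTheory Set
open scoped ContDiff ENNReal

noncomputable section

namespace Cylinder

instance instTwoPiPos : Fact (0 < 2 * Real.pi) := ⟨Real.two_pi_pos⟩

/-- The unit circle `𝕋`, parametrized by the angle `θ ∈ ℝ / 2πℤ`. Its `volume` is arc length `dθ`
(total mass `2π`). -/
abbrev Circ : Type := AddCircle (2 * Real.pi)

/-- The ambient cylinder `𝕋 × ℝ`; its points are written `z = (θ, r)`. -/
abbrev Cyl : Type := Circ × ℝ

/-- `Ω = 𝕋 × (0, 1)`. -/
def Om : Set Cyl := univ ×ˢ Ioo (0 : ℝ) 1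

/-- The measure `dz = dθ dr` on `Ω`. -/
def muOm : Measure Cyl := (volume : Measure Cyl).restrict Om

/-- The space `L²(Ω)`. -/
abbrev L2Om : Type := Lp ℝ 2 muOm

/-! ### Smooth functions -/

/-- `f` is a `C^∞` function on `𝕋 × ℝ`, i.e. it is `C^∞` as a function of `(θ, r) ∈ ℝ × ℝ` that is
`2π`-periodic in `θ`. Restrictions of such functions to the closure of `Ω` form `C^∞(Ω̄)`. -/
def IsSmooth (f : Cyl → ℝ) : Prop :=
  ContDiff ℝ ∞ (fun x : ℝ × ℝ => f ((x.1 : Circ), x.2))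

/-- The classical partial derivative `∂_θ f`. -/
def pdTheta (f : Cyl → ℝ) (z : Cyl) : ℝ :=
  deriv (fun t : ℝ => f (z.1 + (t : Circ), z.2)) 0

/-- The classical partial derivative `∂_r f`. -/
def pdR (f : Cyl → ℝ) (z : Cyl) : ℝ :=
  deriv (fun r : ℝ => f (z.1, r)) z.2

/-- `φ ∈ C_0^∞(Ω)`. -/
structure IsTest (φ : Cyl → ℝ) : Prop where
  smooth : IsSmooth φ
  compact : HasCompactSupport φ
  supp : tsupport φ ⊆ Om

/-- `φ ∈ C_Γ^∞(Ω)`: `φ ∈ C^∞(Ω̄)` and the support of `φ` in `Ω̄` has positive distance to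
`Γ = 𝕋 × {1}`. -/
structure IsSmoothGamma (φ : Cyl → ℝ) : Prop where
  smooth : IsSmooth φ
  supp : ∃ δ > 0, ∀ θ : Circ, ∀ r ∈ Icc (0 : ℝ) 1, 1 - δ ≤ r → φ (θ, r) = 0

/-! ### Weak derivatives (for functions that are locally integrable in `Ω`) -/

/-- `p = ∂_θ u` in the sense of distributions on `Ω`. -/
def IsWeakTheta (u p : Cyl → ℝ) : Prop :=
  ∀ φ, IsTest φ → ∫ z, u z * pdTheta φ z ∂muOm = -∫ z, p z * φ z ∂muOm

/-- `q = ∂_r u` in the sense of distributions on `Ω`. -/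
def IsWeakR (u q : Cyl → ℝ) : Prop :=
  ∀ φ, IsTest φ → ∫ z, u z * pdR φ z ∂muOm = -∫ z, q z * φ z ∂muOm

/-- `d = div (u₁, u₂) = ∂_θ u₁ + ∂_r u₂` in the sense of distributions on `Ω`. -/
def IsWeakDiv (u₁ u₂ d : Cyl → ℝ) : Prop :=
  ∀ φ, IsTest φ →
    ∫ z, (u₁ z * pdTheta φ z + u₂ z * pdR φ z) ∂muOm = -∫ z, d z * φ z ∂muOm

/-! ### Auxiliary facts on smooth functions -/

lemma isOpenQuotientMap_lift :
    IsOpenQuotientMap (fun x : ℝ × ℝ => (((x.1 : ℝ) : Circ), x.2)) := by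
  have h : IsOpenQuotientMap (fun t : ℝ => (t : Circ)) := QuotientAddGroup.isOpenQuotientMap_mk
  exact h.prodMap IsOpenQuotientMap.id

lemma IsSmooth.continuous {f : Cyl → ℝ} (hf : IsSmooth f) : Continuous f :=
  (isOpenQuotientMap_lift.isQuotientMap.continuous_iff).2 (ContDiff.continuous hf)

lemma IsSmooth.add {f g : Cyl → ℝ} (hf : IsSmooth f) (hg : IsSmooth g) : IsSmooth (f + g) :=
  ContDiff.add hf hg

lemma IsSmooth.smul {f : Cyl → ℝ} (c : ℝ) (hf : IsSmooth f) : IsSmooth (c • f) :=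
  ContDiff.const_smul c hf

lemma IsSmooth.mul {f g : Cyl → ℝ} (hf : IsSmooth f) (hg : IsSmooth g) : IsSmooth (f * g) :=
  ContDiff.mul hf hg

lemma IsSmooth.hasDerivAt_theta {f : Cyl → ℝ} (hf : IsSmooth f) (t r : ℝ) :
    HasDerivAt (fun s : ℝ => f ((s : Circ), r)) (pdTheta f ((t : Circ), r)) t := by
  have hd : Differentiable ℝ (fun s : ℝ => f ((s : Circ), r)) := by
    have h1 : Differentiable ℝ (fun x : ℝ × ℝ => f ((x.1 : Circ), x.2)) :=
      ContDiff.differentiable hf (by simp)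
    exact h1.comp (f := fun s : ℝ => (s, r)) (by fun_prop)
  have h2 : pdTheta f ((t : Circ), r) = deriv (fun s : ℝ => f ((s : Circ), r)) t := by
    unfold pdTheta
    have := deriv_comp_const_add (fun s : ℝ => f ((s : Circ), r)) t 0
    simpa using this
  rw [h2]
  exact (hd t).hasDerivAt

lemma IsSmooth.hasDerivAt_r {f : Cyl → ℝ} (hf : IsSmooth f) (θ : Circ) (r : ℝ) :
    HasDerivAt (fun s : ℝ => f (θ, s)) (pdR f (θ, r)) r := by
  obtain ⟨t, rfl⟩ := QuotientAddGroup.mk_surjective θ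
  have hd : Differentiable ℝ (fun s : ℝ => f ((t : Circ), s)) := by
    have h1 : Differentiable ℝ (fun x : ℝ × ℝ => f ((x.1 : Circ), x.2)) :=
      ContDiff.differentiable hf (by simp)
    exact h1.comp (f := fun s : ℝ => (t, s)) (by fun_prop)
  exact (hd r).hasDerivAt

lemma IsSmooth.pdTheta {f : Cyl → ℝ} (hf : IsSmooth f) : IsSmooth (pdTheta f) := by
  have h1 : Differentiable ℝ (fun x : ℝ × ℝ => f ((x.1 : Circ), x.2)) :=
    ContDiff.differentiable hf (by simp)
  have h2 : (fun x : ℝ × ℝ => Cylinder.pdTheta f ((x.1 : Circ), x.2)) =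
      fun x => fderiv ℝ (fun x : ℝ × ℝ => f ((x.1 : Circ), x.2)) x (1, 0) := by
    funext x
    have h3 : HasDerivAt (fun s : ℝ => (s, x.2)) ((1 : ℝ), (0 : ℝ)) x.1 :=
      (hasDerivAt_id _).prodMk (hasDerivAt_const _ _)
    have h4 := (h1 x).hasFDerivAt.comp_hasDerivAt x.1 h3
    exact (hf.hasDerivAt_theta x.1 x.2).unique h4
  unfold IsSmooth
  rw [h2]
  exact (ContDiff.fderiv_right hf (m := ∞) (by simp)).clm_apply contDiff_const

lemma IsSmooth.pdR {f : Cyl → ℝ} (hf : IsSmooth f) : IsSmooth (pdR f) := by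
  have h1 : Differentiable ℝ (fun x : ℝ × ℝ => f ((x.1 : Circ), x.2)) :=
    ContDiff.differentiable hf (by simp)
  have h2 : (fun x : ℝ × ℝ => Cylinder.pdR f ((x.1 : Circ), x.2)) =
      fun x => fderiv ℝ (fun x : ℝ × ℝ => f ((x.1 : Circ), x.2)) x (0, 1) := by
    funext x
    have h3 : HasDerivAt (fun s : ℝ => (x.1, s)) ((0 : ℝ), (1 : ℝ)) x.2 :=
      (hasDerivAt_const _ _).prodMk (hasDerivAt_id _)
    have h4 := (h1 x).hasFDerivAt.comp_hasDerivAt x.2 h3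
    exact (hf.hasDerivAt_r (x.1 : Circ) x.2).unique h4
  unfold IsSmooth
  rw [h2]
  exact (ContDiff.fderiv_right hf (m := ∞) (by simp)).clm_apply contDiff_const

lemma pdTheta_add {f g : Cyl → ℝ} (hf : IsSmooth f) (hg : IsSmooth g) :
    pdTheta (f + g) = pdTheta f + pdTheta g := by
  funext ⟨θ, r⟩
  obtain ⟨t, rfl⟩ := QuotientAddGroup.mk_surjective θ
  exact ((hf.add hg).hasDerivAt_theta t r).unique
    ((hf.hasDerivAt_theta t r).add (hg.hasDerivAt_theta t r))

lemma pdR_add {f g : Cyl → ℝ} (hf : IsSmooth f) (hg : IsSmooth g) :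
    pdR (f + g) = pdR f + pdR g := by
  funext ⟨θ, r⟩
  exact ((hf.add hg).hasDerivAt_r θ r).unique ((hf.hasDerivAt_r θ r).add (hg.hasDerivAt_r θ r))

lemma pdTheta_smul {f : Cyl → ℝ} (c : ℝ) (hf : IsSmooth f) :
    pdTheta (c • f) = c • pdTheta f := by
  funext ⟨θ, r⟩
  obtain ⟨t, rfl⟩ := QuotientAddGroup.mk_surjective θ
  exact ((hf.smul c).hasDerivAt_theta t r).unique ((hf.hasDerivAt_theta t r).const_smul c)

lemma pdR_smul {f : Cyl → ℝ} (c : ℝ) (hf : IsSmooth f) : pdR (c • f) = c • pdR f := by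
  funext ⟨θ, r⟩
  exact ((hf.smul c).hasDerivAt_r θ r).unique ((hf.hasDerivAt_r θ r).const_smul c)

lemma measurableSet_Om : MeasurableSet Om := MeasurableSet.univ.prod measurableSet_Ioo

lemma Om_subset : Om ⊆ univ ×ˢ Icc (0 : ℝ) 1 := prod_mono_right Ioo_subset_Icc_self

lemma isCompact_closedOm : IsCompact ((univ : Set Circ) ×ˢ Icc (0 : ℝ) 1) :=
  isCompact_univ.prod isCompact_Icc

instance : IsFiniteMeasure muOm := by
  refine ⟨?_⟩
  rw [muOm, Measure.restrict_apply_univ]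
  exact (measure_mono Om_subset).trans_lt isCompact_closedOm.measure_lt_top

lemma exists_bound {f : Cyl → ℝ} (hf : Continuous f) : ∃ C, ∀ᵐ z ∂muOm, ‖f z‖ ≤ C := by
  obtain ⟨C, hC⟩ := isCompact_closedOm.exists_bound_of_continuousOn hf.continuousOn
  refine ⟨C, ?_⟩
  rw [muOm, ae_restrict_iff' measurableSet_Om]
  exact Filter.Eventually.of_forall fun z hz => hC z (Om_subset hz)

lemma memLp_of_continuous {f : Cyl → ℝ} (hf : Continuous f) : MemLp f 2 muOm := by
  obtain ⟨C, hC⟩ := exists_bound hf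
  exact MemLp.of_bound hf.aestronglyMeasurable C hC

lemma integrable_mul_of_memLp {u φ : Cyl → ℝ} (hu : MemLp u 2 muOm) (hφ : Continuous φ) :
    Integrable (fun z => u z * φ z) muOm :=
  hu.integrable_mul (memLp_of_continuous hφ)

lemma integrable_of_continuous {f : Cyl → ℝ} (hf : Continuous f) : Integrable f muOm :=
  (memLp_of_continuous hf).integrable (by norm_num)

lemma integral_pdTheta {f : Cyl → ℝ} (hf : IsSmooth f) : ∫ z, pdTheta f z ∂muOm = 0 := by
  have hi : IntegrableOn (pdTheta f) (univ ×ˢ Ioo (0 : ℝ) 1)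
      ((volume : Measure Circ).prod (volume : Measure ℝ)) :=
    integrable_of_continuous hf.pdTheta.continuous
  have h0 : ∀ r : ℝ, ∫ θ : Circ, pdTheta f (θ, r) = 0 := by
    intro r
    rw [← AddCircle.intervalIntegral_preimage (2 * Real.pi) 0 (fun θ => pdTheta f (θ, r))]
    rw [intervalIntegral.integral_eq_sub_of_hasDerivAt (f := fun s : ℝ => f ((s : Circ), r))]
    · simp only [zero_add, QuotientAddGroup.mk_zero]
      rw [AddCircle.coe_period, sub_self]
    · intro t _
      exact hf.hasDerivAt_theta t r
    · have : Continuous fun t : ℝ => pdTheta f ((t : Circ), r) :=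
        hf.pdTheta.continuous.comp (by fun_prop)
      exact this.intervalIntegrable _ _
  change ∫ z in univ ×ˢ Ioo (0 : ℝ) 1, pdTheta f z
    ∂((volume : Measure Circ).prod (volume : Measure ℝ)) = 0
  rw [IntegrableOn, ← Measure.prod_restrict] at hi
  rw [← Measure.prod_restrict, integral_prod_symm _ hi]
  simp [h0]

lemma integral_pdR {f : Cyl → ℝ} (hf : IsSmooth f) (hs : tsupport f ⊆ Om) :
    ∫ z, pdR f z ∂muOm = 0 := by
  have hi : IntegrableOn (pdR f) (univ ×ˢ Ioo (0 : ℝ) 1)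
      ((volume : Measure Circ).prod (volume : Measure ℝ)) :=
    integrable_of_continuous hf.pdR.continuous
  have hz : ∀ (θ : Circ) (r : ℝ), r ∉ Ioo (0 : ℝ) 1 → f (θ, r) = 0 := by
    intro θ r hr
    apply image_eq_zero_of_notMem_tsupport
    intro h
    exact hr (hs h).2
  have h0 : ∀ θ : Circ, ∫ r in Ioo (0 : ℝ) 1, pdR f (θ, r) = 0 := by
    intro θ
    rw [← integral_Ioc_eq_integral_Ioo, ← intervalIntegral.integral_of_le zero_le_one]
    rw [intervalIntegral.integral_eq_sub_of_hasDerivAt (f := fun s : ℝ => f (θ, s))]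
    · rw [hz θ 1 (by simp), hz θ 0 (by simp), sub_self]
    · intro t _
      exact hf.hasDerivAt_r θ t
    · have : Continuous fun t : ℝ => pdR f (θ, t) :=
        hf.pdR.continuous.comp (by fun_prop)
      exact this.intervalIntegrable _ _
  change ∫ z in univ ×ˢ Ioo (0 : ℝ) 1, pdR f z
    ∂((volume : Measure Circ).prod (volume : Measure ℝ)) = 0
  rw [setIntegral_prod _ hi]
  simp [h0]

/-- The classical divergence of a smooth field is its weak divergence. -/
lemma isWeakDiv_of_smooth {f g : Cyl → ℝ} (hf : IsSmooth f) (hg : IsSmooth g) :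
    IsWeakDiv f g (pdTheta f + pdR g) := by
  intro φ hφ
  have h1 := integral_pdTheta (hf.mul hφ.smooth)
  have h2 := integral_pdR (hg.mul hφ.smooth)
    ((tsupport_mul_subset_right (f := g) (g := φ)).trans hφ.supp)
  have e1 : pdTheta (f * φ) = fun z => pdTheta f z * φ z + f z * pdTheta φ z := by
    funext ⟨θ, r⟩
    obtain ⟨t, rfl⟩ := QuotientAddGroup.mk_surjective θ
    exact ((hf.mul hφ.smooth).hasDerivAt_theta t r).unique
      ((hf.hasDerivAt_theta t r).mul (hφ.smooth.hasDerivAt_theta t r))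
  have e2 : pdR (g * φ) = fun z => pdR g z * φ z + g z * pdR φ z := by
    funext ⟨θ, r⟩
    exact ((hg.mul hφ.smooth).hasDerivAt_r θ r).unique
      ((hg.hasDerivAt_r θ r).mul (hφ.smooth.hasDerivAt_r θ r))
  have i1 : Integrable (pdTheta (f * φ)) muOm :=
    integrable_of_continuous (hf.mul hφ.smooth).pdTheta.continuous
  have i2 : Integrable (pdR (g * φ)) muOm :=
    integrable_of_continuous (hg.mul hφ.smooth).pdR.continuous
  have i3 : Integrable (fun z => (pdTheta f + pdR g) z * φ z) muOm :=
    integrable_of_continuous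
      ((hf.pdTheta.continuous.add hg.pdR.continuous).mul hφ.smooth.continuous)
  have h3 : ∫ z, (pdTheta (f * φ) z + pdR (g * φ) z) ∂muOm = 0 := by
    rw [integral_add i1 i2, h1, h2, add_zero]
  rw [eq_neg_iff_add_eq_zero, ← integral_add _ i3, ← h3]
  · refine integral_congr_ae (Filter.Eventually.of_forall fun z => ?_)
    simp only [e1, e2, Pi.add_apply]
    ring
  · exact integrable_of_continuous ((hf.continuous.mul hφ.smooth.pdTheta.continuous).add
      (hg.continuous.mul hφ.smooth.pdR.continuous))

/-! ### The spaces `H(div, Ω)` and `H(div, Ω; w⁻¹)` -/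

/-- The subspace of `L²(Ω)³` of all triples `(u₁, u₂, d)` with `d = div (u₁, u₂)` weakly. -/
def HdivSub : Submodule ℝ (PiLp 2 (fun _ : Fin 3 => L2Om)) where
  carrier := {U | IsWeakDiv (U 0) (U 1) (U 2)}
  add_mem' := by
    intro U V hU hV φ hφ
    have a := hU φ hφ
    have b := hV φ hφ
    have iT := hφ.smooth.pdTheta.continuous
    have iR := hφ.smooth.pdR.continuous
    have iφ := hφ.smooth.continuous
    have e1 : ∫ z, ((U + V) 0 z * pdTheta φ z + (U + V) 1 z * pdR φ z) ∂muOm =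
        ∫ z, ((U 0 z * pdTheta φ z + U 1 z * pdR φ z) +
          (V 0 z * pdTheta φ z + V 1 z * pdR φ z)) ∂muOm := by
      refine integral_congr_ae ?_
      filter_upwards [Lp.coeFn_add (U 0) (V 0), Lp.coeFn_add (U 1) (V 1)] with z h0 h1
      simp only [PiLp.add_apply, h0, h1, Pi.add_apply]
      ring
    have e2 : ∫ z, (U + V) 2 z * φ z ∂muOm = ∫ z, (U 2 z * φ z + V 2 z * φ z) ∂muOm := by
      refine integral_congr_ae ?_
      filter_upwards [Lp.coeFn_add (U 2) (V 2)] with z h0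
      simp only [PiLp.add_apply, h0, Pi.add_apply]
      ring
    have e3 := integral_add
      ((integrable_mul_of_memLp (Lp.memLp (U 0)) iT).add
        (integrable_mul_of_memLp (Lp.memLp (U 1)) iR))
      ((integrable_mul_of_memLp (Lp.memLp (V 0)) iT).add
        (integrable_mul_of_memLp (Lp.memLp (V 1)) iR))
    have e4 := integral_add (integrable_mul_of_memLp (Lp.memLp (U 2)) iφ)
      (integrable_mul_of_memLp (Lp.memLp (V 2)) iφ)
    rw [e1, e2, e4, neg_add, ← a, ← b]
    exact e3
  zero_mem' := by
    intro φ _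
    have h0 := Lp.coeFn_zero ℝ 2 muOm
    have e1 : ∫ z, ((0 : PiLp 2 (fun _ : Fin 3 => L2Om)) 0 z * pdTheta φ z +
        (0 : PiLp 2 (fun _ : Fin 3 => L2Om)) 1 z * pdR φ z) ∂muOm = ∫ z, (0 : ℝ) ∂muOm := by
      refine integral_congr_ae ?_
      filter_upwards [h0] with z h0
      rw [Pi.zero_apply] at h0
      simp only [PiLp.zero_apply, h0, zero_mul, add_zero]
    have e2 : ∫ z, (0 : PiLp 2 (fun _ : Fin 3 => L2Om)) 2 z * φ z ∂muOm = ∫ z, (0 : ℝ) ∂muOm := by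
      refine integral_congr_ae ?_
      filter_upwards [h0] with z h0
      rw [Pi.zero_apply] at h0
      simp only [PiLp.zero_apply, h0, zero_mul]
    rw [e1, e2]
    simp
  smul_mem' := by
    intro c U hU φ hφ
    have a := hU φ hφ
    have e1 : ∫ z, ((c • U) 0 z * pdTheta φ z + (c • U) 1 z * pdR φ z) ∂muOm =
        ∫ z, c * (U 0 z * pdTheta φ z + U 1 z * pdR φ z) ∂muOm := by
      refine integral_congr_ae ?_
      filter_upwards [Lp.coeFn_smul c (U 0), Lp.coeFn_smul c (U 1)] with z h0 h1
      simp only [PiLp.smul_apply, h0, h1, Pi.smul_apply, smul_eq_mul]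
      ring
    have e2 : ∫ z, (c • U) 2 z * φ z ∂muOm = ∫ z, c * (U 2 z * φ z) ∂muOm := by
      refine integral_congr_ae ?_
      filter_upwards [Lp.coeFn_smul c (U 2)] with z h0
      simp only [PiLp.smul_apply, h0, Pi.smul_apply, smul_eq_mul]
      ring
    rw [e1, e2, integral_const_mul, integral_const_mul, a, mul_neg]

/-- `H(div, Ω)`: a field `𝐮 = (u₁, u₂) ∈ L²(Ω)²` whose weak divergence `d` lies in `L²(Ω)` is stored
as the triple `(u₁, u₂, d)`; here `d` is determined by `𝐮`. The induced norm is
`(‖u₁‖² + ‖u₂‖² + ‖div 𝐮‖²)^{1/2}`. -/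
def Hdiv : Type := HdivSub

instance : NormedAddCommGroup Hdiv := inferInstanceAs (NormedAddCommGroup HdivSub)

instance : NormedSpace ℝ Hdiv := inferInstanceAs (NormedSpace ℝ HdivSub)

/-- The element of `H(div, Ω)` given by `L²` functions `u₁, u₂` with weak divergence `d ∈ L²`. -/
def Hdiv.mk {u₁ u₂ d : Cyl → ℝ} (h₁ : MemLp u₁ 2 muOm) (h₂ : MemLp u₂ 2 muOm)
    (hd : MemLp d 2 muOm) (h : IsWeakDiv u₁ u₂ d) : Hdiv :=
  ⟨WithLp.toLp 2 ![h₁.toLp u₁, h₂.toLp u₂, hd.toLp d], by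
    intro φ hφ
    have a := h φ hφ
    have e1 : ∫ z, (h₁.toLp u₁ z * pdTheta φ z + h₂.toLp u₂ z * pdR φ z) ∂muOm =
        ∫ z, (u₁ z * pdTheta φ z + u₂ z * pdR φ z) ∂muOm := by
      refine integral_congr_ae ?_
      filter_upwards [h₁.coeFn_toLp, h₂.coeFn_toLp] with z h0 h1
      rw [h0, h1]
    have e2 : ∫ z, hd.toLp d z * φ z ∂muOm = ∫ z, d z * φ z ∂muOm := by
      refine integral_congr_ae ?_
      filter_upwards [hd.coeFn_toLp] with z h0
      rw [h0]
    exact e1.trans (a.trans (congrArg Neg.neg e2.symm))⟩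

/-- `H(div, Ω; w⁻¹)`, `w = r^α`, as a subset of `H(div, Ω)`: the fields with
`∫_Ω 𝐮 · A⁻¹ 𝐮 dz = ∫_Ω (u₁² + r^{-α} u₂²) dz < ∞`. -/
def HdivW (α : ℝ) : Set Hdiv :=
  {U | ∫⁻ z, ENNReal.ofReal ((U.1 0 z) ^ 2 + z.2 ^ (-α) * (U.1 1 z) ^ 2) ∂muOm < ⊤}

/-- The space `[C^∞(Ω̄)]²`. -/
def SmoothField : Submodule ℝ ((Cyl → ℝ) × (Cyl → ℝ)) where
  carrier := {U | IsSmooth U.1 ∧ IsSmooth U.2}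
  add_mem' := fun hU hV => ⟨hU.1.add hV.1, hU.2.add hV.2⟩
  zero_mem' := ⟨contDiff_const, contDiff_const⟩
  smul_mem' := fun c _ hU => ⟨hU.1.smul c, hU.2.smul c⟩

/-- The natural map `[C^∞(Ω̄)]² → H(div, Ω)`, `(u₁, u₂) ↦ (u₁, u₂)` restricted to `Ω`. -/
def SmoothField.toHdiv : SmoothField →ₗ[ℝ] Hdiv where
  toFun U := Hdiv.mk (memLp_of_continuous U.2.1.continuous) (memLp_of_continuous U.2.2.continuous)
    (memLp_of_continuous (U.2.1.pdTheta.continuous.add U.2.2.pdR.continuous))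
    (isWeakDiv_of_smooth U.2.1 U.2.2)
  map_add' := by
    intro U V
    apply Subtype.ext
    apply PiLp.ext
    intro i
    fin_cases i
    · rfl
    · rfl
    · have hU := memLp_of_continuous (U.2.1.pdTheta.continuous.add U.2.2.pdR.continuous)
      have hV := memLp_of_continuous (V.2.1.pdTheta.continuous.add V.2.2.pdR.continuous)
      refine Eq.trans (b := (hU.add hV).toLp _) ?_ (MemLp.toLp_add hU hV)
      refine MemLp.toLp_congr (memLp_of_continuous
        ((U + V).2.1.pdTheta.continuous.add (U + V).2.2.pdR.continuous)) _
        (Filter.EventuallyEq.of_eq ?_)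
      change pdTheta (U.1.1 + V.1.1) + pdR (U.1.2 + V.1.2) = _
      rw [pdTheta_add U.2.1 V.2.1, pdR_add U.2.2 V.2.2]
      abel
  map_smul' := by
    intro c U
    apply Subtype.ext
    apply PiLp.ext
    intro i
    fin_cases i
    · rfl
    · rfl
    · have h := memLp_of_continuous (U.2.1.pdTheta.continuous.add U.2.2.pdR.continuous)
      refine Eq.trans (b := (h.const_smul c).toLp _) ?_ (MemLp.toLp_const_smul c h)
      refine MemLp.toLp_congr (memLp_of_continuous
        ((c • U).2.1.pdTheta.continuous.add (c • U).2.2.pdR.continuous)) _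
        (Filter.EventuallyEq.of_eq ?_)
      change pdTheta (c • U.1.1) + pdR (c • U.1.2) = _
      rw [pdTheta_smul c U.2.1, pdR_smul c U.2.2, smul_add]

/-! ### The spaces `H^{1/2}(Γ*)`, `H^{-1/2}(Γ*)` and the normal trace, `Γ* = 𝕋 × {0} ≅ 𝕋` -/

/-- The space `L²(Γ*) = L²(𝕋)`. -/
abbrev L2Circ : Type := Lp ℝ 2 (volume : Measure Circ)

/-- The `n`-th Fourier coefficient of `v ∈ L²(𝕋)`. -/
def fcoeff (v : L2Circ) (n : ℤ) : ℂ := fourierCoeff (fun θ : Circ => ((v θ : ℝ) : ℂ)) n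

lemma volume_circ : (volume : Measure Circ) =
    ENNReal.ofReal (2 * Real.pi) • (AddCircle.haarAddCircle : Measure Circ) :=
  AddCircle.volume_eq_smul_haarAddCircle

lemma ofReal_two_pi_ne_zero : ENNReal.ofReal (2 * Real.pi) ≠ 0 := by
  simpa using Real.pi_pos

lemma integrable_ofReal_haar (v : L2Circ) :
    Integrable (fun θ : Circ => ((v θ : ℝ) : ℂ)) AddCircle.haarAddCircle := by
  have h : Integrable (fun θ : Circ => ((v θ : ℝ) : ℂ)) (volume : Measure Circ) :=
    ((Lp.memLp v).integrable (by norm_num)).ofReal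
  generalize (fun θ : Circ => ((v θ : ℝ) : ℂ)) = f at h ⊢
  rw [volume_circ] at h
  exact (integrable_smul_measure ofReal_two_pi_ne_zero ENNReal.ofReal_ne_top).1 h

lemma ae_haar {p : Circ → Prop} (h : ∀ᵐ θ ∂(volume : Measure Circ), p θ) :
    ∀ᵐ θ ∂(AddCircle.haarAddCircle : Measure Circ), p θ := by
  rw [volume_circ, ae_iff, Measure.smul_apply, smul_eq_mul] at h
  exact ae_iff.2 ((mul_eq_zero.1 h).resolve_left ofReal_two_pi_ne_zero)

lemma fcoeff_add (u v : L2Circ) (n : ℤ) : fcoeff (u + v) n = fcoeff u n + fcoeff v n := by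
  have h := congrFun (fourierCoeff.add (integrable_ofReal_haar u) (integrable_ofReal_haar v)) n
  rw [Pi.add_apply] at h
  refine Eq.trans ?_ h
  refine congrFun (fourierCoeff_congr_ae ?_) n
  filter_upwards [ae_haar (Lp.coeFn_add u v)] with θ hθ
  rw [hθ]
  simp

lemma fcoeff_smul (c : ℝ) (v : L2Circ) (n : ℤ) : fcoeff (c • v) n = (c : ℂ) * fcoeff v n := by
  refine Eq.trans ?_ (fourierCoeff.const_mul (fun θ : Circ => ((v θ : ℝ) : ℂ)) (c : ℂ) n)
  refine congrFun (fourierCoeff_congr_ae ?_) n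
  filter_upwards [ae_haar (Lp.coeFn_smul c v)] with θ hθ
  rw [hθ]
  simp

/-- The subspace of `L²(𝕋) × ℓ²(ℤ)` of all pairs `(v, (|n|^{1/2} v̂(n))ₙ)`. -/
def HhalfSub : Submodule ℝ (WithLp 2 (L2Circ × lp (fun _ : ℤ => ℂ) 2)) where
  carrier := {x | ∀ n : ℤ, x.snd n = ((Real.sqrt |(n : ℝ)| : ℝ) : ℂ) * fcoeff x.fst n}
  add_mem' := by
    intro x y hx hy n
    have a := hx n
    have b := hy n
    rw [WithLp.add_snd, WithLp.add_fst, fcoeff_add, lp.coeFn_add, Pi.add_apply, a, b, mul_add]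
  zero_mem' := by
    intro n
    have h : fcoeff 0 n = 0 := by
      have := fcoeff_smul 0 0 n
      simpa using this
    simp [h]
  smul_mem' := by
    intro c x hx n
    have a := hx n
    rw [WithLp.smul_snd, WithLp.smul_fst, fcoeff_smul, lp.coeFn_smul, Pi.smul_apply, a,
      Complex.real_smul]
    ring

/-- `H^{1/2}(Γ*)`: the `v ∈ L²(𝕋)` with `∑ₙ |n| |v̂(n)|² < ∞`, stored as the pair
`(v, (|n|^{1/2} v̂(n))ₙ) ∈ L²(𝕋) × ℓ²(ℤ)`, whose second entry is determined by `v`. The induced norm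
is `(‖v‖² + ∑ₙ |n| |v̂(n)|²)^{1/2}`. -/
def Hhalf : Type := HhalfSub

instance : NormedAddCommGroup Hhalf := inferInstanceAs (NormedAddCommGroup HhalfSub)

instance : NormedSpace ℝ Hhalf := inferInstanceAs (NormedSpace ℝ HhalfSub)

/-- `H^{-1/2}(Γ*)`, the dual space of `H^{1/2}(Γ*)`. -/
abbrev HminusHalf : Type := StrongDual ℝ Hhalf

/-- The embedding `H^{1/2}(Γ*) → L²(Γ*)`. -/
def Hhalf.toL2 : Hhalf →L[ℝ] L2Circ :=
  (WithLp.fstL 2 ℝ L2Circ (lp (fun _ : ℤ => ℂ) 2)).comp HhalfSub.subtypeL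

lemma memLp_trace {f : Cyl → ℝ} (hf : IsSmooth f) :
    MemLp (fun θ : Circ => f (θ, 0)) 2 volume := by
  have hc : Continuous fun θ : Circ => f (θ, 0) := hf.continuous.comp (by fun_prop)
  obtain ⟨C, hC⟩ := isCompact_univ.exists_bound_of_continuousOn hc.continuousOn
  exact MemLp.of_bound hc.aestronglyMeasurable C
    (Filter.Eventually.of_forall fun θ => hC θ (mem_univ θ))

/-- The boundary values `𝐮 · ν = -u₂` on `Γ*` of a smooth field `𝐮 = (u₁, u₂)`, as an element of
`L²(Γ*)`. -/
def SmoothField.normalL2 : SmoothField →ₗ[ℝ] L2Circ where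
  toFun U := -(memLp_trace U.2.2).toLp _
  map_add' := by
    intro U V
    rw [← neg_add, ← MemLp.toLp_add]
    rfl
  map_smul' := by
    intro c U
    rw [RingHom.id_apply, smul_neg, ← MemLp.toLp_const_smul]
    rfl

/-- The normal trace `𝐮 · ν = -u₂` on `Γ*` of a smooth field, as the element
`v ↦ ∫_{Γ*} (𝐮 · ν) v dS` of `H^{-1/2}(Γ*)` (with `L²(Γ*)` as pivot space). -/
def SmoothField.normalTrace : SmoothField →ₗ[ℝ] HminusHalf where
  toFun U := (innerSL ℝ (SmoothField.normalL2 U)).comp Hhalf.toL2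
  map_add' := by
    intro U V
    ext v
    simp [map_add]
  map_smul' := by
    intro c U
    ext v
    simp [map_smul]

/-- The normal trace `γ_ν : H(div, Ω) → H^{-1/2}(Γ*)`: the extension by continuity of the map
`𝐮 ↦ 𝐮 · ν = -u₂`, `𝐮 ∈ [C^∞(Ω̄)]²`. -/
def normalTrace : Hdiv →L[ℝ] HminusHalf :=
  LinearMap.extendOfNorm (σ₁₂ := RingHom.id ℝ) (F := HminusHalf) (Eₗ := Hdiv)
    SmoothField.normalTrace SmoothField.toHdiv

/-- `γ` is a bounded linear operator `H(div, Ω) → H^{-1/2}(Γ*)` with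
`⟨γ 𝐮, v⟩ = ∫_{Γ*} (𝐮 · ν) v dS = -∫_𝕋 u₂(θ, 0) v(θ) dθ` for all `𝐮 ∈ [C^∞(Ω̄)]²`. -/
def IsNormalTrace (γ : Hdiv →L[ℝ] HminusHalf) : Prop :=
  ∀ (U : SmoothField) (v : Hhalf),
    γ (SmoothField.toHdiv U) v = -∫ θ : Circ, U.1.2 (θ, 0) * Hhalf.toL2 v θ

/-! ### The spaces `H¹(Ω; w)`, `H¹_Γ(Ω; w)` and `H²(Ω; w)` for `w = r^α` -/

/-- An element `u` of `H¹(Ω; w)`, together with its weak gradient `∇u = (∂_θ u, ∂_r u)`: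
`u ∈ L²(Ω)` and `∫_Ω ∇u · A∇u dz = ∫_Ω ((∂_θ u)² + r^α (∂_r u)²) dz < ∞`. -/
structure H1w (α : ℝ) where
  val : Cyl → ℝ
  dtheta : Cyl → ℝ
  dr : Cyl → ℝ
  memLp_val : MemLp val 2 muOm
  memLp_dtheta : MemLp dtheta 2 muOm
  memLp_dr : MemLp (fun z => z.2 ^ (α / 2) * dr z) 2 muOm
  weak_dtheta : IsWeakTheta val dtheta
  weak_dr : IsWeakR val dr

/-- `H¹_Γ(Ω; w)`, the closure of `C_Γ^∞(Ω)` in `H¹(Ω; w)`. -/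
def H1wGamma (α : ℝ) : Set (H1w α) :=
  {v | ∀ ε > (0 : ℝ≥0∞), ∃ φ, IsSmoothGamma φ ∧
    ∫⁻ z, ENNReal.ofReal ((v.val z - φ z) ^ 2 + (v.dtheta z - pdTheta φ z) ^ 2 +
      z.2 ^ α * (v.dr z - pdR φ z) ^ 2) ∂muOm < ε}

/-- An element `u` of `H²(Ω; w)`: `u ∈ H¹(Ω; w)` and `div (A∇u) ∈ L²(Ω)`, where
`A∇u = (∂_θ u, r^α ∂_r u)`. -/
structure H2w (α : ℝ) extends H1w α where
  divA : Cyl → ℝ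
  memLp_divA : MemLp divA 2 muOm
  weak_divA : IsWeakDiv dtheta (fun z => z.2 ^ α * dr z) divA

lemma memLp_flux {α : ℝ} (hα : 0 ≤ α) (u : H1w α) :
    MemLp (fun z => z.2 ^ α * u.dr z) 2 muOm := by
  have hm : Measurable fun z : Cyl => z.2 ^ (α / 2) := measurable_snd.pow_const _
  have hae : ∀ᵐ z ∂muOm, z ∈ Om := ae_restrict_mem measurableSet_Om
  have h1 : MemLp (fun z : Cyl => z.2 ^ (α / 2) * (z.2 ^ (α / 2) * u.dr z)) 2 muOm := by
    refine MemLp.of_le u.memLp_dr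
      (hm.aestronglyMeasurable.mul u.memLp_dr.aestronglyMeasurable) ?_
    filter_upwards [hae] with z hz
    have h0 : 0 ≤ z.2 ^ (α / 2) := Real.rpow_nonneg hz.2.1.le _
    have h2 : z.2 ^ (α / 2) ≤ 1 := Real.rpow_le_one hz.2.1.le hz.2.2.le (by positivity)
    rw [norm_mul, Real.norm_of_nonneg h0]
    exact mul_le_of_le_one_left (norm_nonneg _) h2
  refine (memLp_congr_ae ?_).1 h1
  filter_upwards [hae] with z hz
  rw [← mul_assoc, ← Real.rpow_add hz.2.1, add_halves]

/-- The flux `A∇u ∈ H(div, Ω)` of `u ∈ H²(Ω; w)`. -/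
def H2w.flux {α : ℝ} (hα : 0 ≤ α) (u : H2w α) : Hdiv :=
  Hdiv.mk u.memLp_dtheta (memLp_flux hα u.toH1w) u.memLp_divA u.weak_divA

/-- The conormal derivative `∂u/∂ν_A = γ_ν(A∇u) ∈ H^{-1/2}(Γ*)` on `Γ*`. -/
def H2w.conormal {α : ℝ} (hα : 0 ≤ α) (u : H2w α) : HminusHalf :=
  normalTrace (u.flux hα)

end Cylinder

end

/-! The proof revolves around Green's formula ∫_Ω (𝐮 · ∇φ + φ div 𝐮) dz = ⟨γ_ν 𝐮, φ⟩ for smooth φ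
vanishing near Γ. Its left side, `pairing`, makes sense for every 𝐮 in H(div, Ω).

The trace exists and is unique because of density and a bound. For density (`denseRange_toHdiv`), a
field orthogonal to all smooth fields satisfies 𝐮 = ∇d with d = div 𝐮 and d = 0 on both boundary
circles. Hence Δd = d and everything vanishes. This is carried out one Fourier mode in θ at a time,
where it becomes d'' = (1 + n²) d on (0, 1) with Dirichlet conditions (`eq_zero_of_weak_dirichlet`).
For the bound, e^{inθ} is extended from Γ* into Ω by a cutoff times e^{-(1+|n|)r}, whose squared H¹
norm is of order 1 + |n| (`exists_extension_bound`). Green's formula with the extensions of partial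
Fourier sums of v then recovers ⟨γ_ν 𝐮, v⟩ up to the tail of the H^{1/2} norm of v
(`exists_trace_sub_pairing_bound`). The empty partial sum gives boundedness, and long partial sums
express the trace as a limit of pairings.

For (i), cut φ off at height ε, so that it becomes a test function. The only new term is ∫ u₂ φ
χ_ε'. As r^{-α/2} u₂ is in L² and α ≥ 1, this term is bounded by the L² norm of r^{-α/2} u₂ on a
strip of height 2ε, up to a constant, and tends to 0 (`abs_flux_cutoff_le`). So all pairings vanish
(`weighted_green`), and with them the trace.

For (ii), r^{-α} (r^α ∂_r u)² = r^α (∂_r u)², so A∇u lies in H(div, Ω; w⁻¹) and (i) applies. The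
last identity is `weighted_green` for smooth φ, carried over to H¹_Γ(Ω; w) by approximation in the
energy norm. -/

namespace Cylinder

/-! ### Square-integrable functions -/

section L2

variable {X : Type*} [MeasurableSpace X] {μ : Measure X}

lemma norm_toLp_sq {f : X → ℝ} (hf : MemLp f 2 μ) : ‖hf.toLp f‖ ^ 2 = ∫ x, f x ^ 2 ∂μ := by
  rw [← real_inner_self_eq_norm_sq, L2.inner_def]
  refine integral_congr_ae ?_
  filter_upwards [hf.coeFn_toLp] with x hx
  simp [hx, pow_two]

lemma norm_Lp_sq (f : Lp ℝ 2 μ) : ‖f‖ ^ 2 = ∫ x, f x ^ 2 ∂μ := by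
  rw [← real_inner_self_eq_norm_sq, L2.inner_def]
  simp [pow_two]

lemma inner_toLp {f g : X → ℝ} (hf : MemLp f 2 μ) (hg : MemLp g 2 μ) :
    inner ℝ (hf.toLp f) (hg.toLp g) = ∫ x, f x * g x ∂μ := by
  rw [L2.inner_def]
  refine integral_congr_ae ?_
  filter_upwards [hf.coeFn_toLp, hg.coeFn_toLp] with x hx hy
  simp [hx, hy, mul_comm]

/-- The Cauchy–Schwarz inequality. -/
lemma abs_integral_mul_le {f g : X → ℝ} (hf : MemLp f 2 μ) (hg : MemLp g 2 μ) :
    |∫ x, f x * g x ∂μ| ≤ √(∫ x, f x ^ 2 ∂μ) * √(∫ x, g x ^ 2 ∂μ) := by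
  rw [← norm_toLp_sq hf, ← norm_toLp_sq hg, Real.sqrt_sq (norm_nonneg _),
    Real.sqrt_sq (norm_nonneg _), ← inner_toLp hf hg]
  exact abs_real_inner_le_norm _ _

end L2

/-! ### The measure on `Ω` as a product -/

lemma muOm_eq_prod :
    muOm = (volume : Measure Circ).prod ((volume : Measure ℝ).restrict (Ioo 0 1)) := by
  change (volume : Measure (Circ × ℝ)).restrict (univ ×ˢ Ioo (0 : ℝ) 1) = _
  rw [Measure.volume_eq_prod, ← Measure.prod_restrict, Measure.restrict_univ]

lemma ae_mem_Om : ∀ᵐ z ∂muOm, z ∈ Om := ae_restrict_mem measurableSet_Om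

lemma integral_muOm {f : Cyl → ℝ} (hf : Integrable f muOm) :
    ∫ z, f z ∂muOm = ∫ r in Ioo (0 : ℝ) 1, ∫ θ : Circ, f (θ, r) := by
  rw [muOm_eq_prod] at hf ⊢
  exact integral_prod_symm _ hf

lemma integral_muOm' {f : Cyl → ℝ} (hf : Integrable f muOm) :
    ∫ z, f z ∂muOm = ∫ θ : Circ, ∫ r in Ioo (0 : ℝ) 1, f (θ, r) := by
  rw [muOm_eq_prod] at hf ⊢
  exact integral_prod _ hf

/-! ### Trigonometric functions times functions of `r` -/

lemma pdTheta_eq_of_hasDerivAt {f : Cyl → ℝ} {t r a : ℝ}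
    (h : HasDerivAt (fun s : ℝ => f ((s : Circ), r)) a t) : pdTheta f ((t : Circ), r) = a := by
  have h2 : pdTheta f ((t : Circ), r) = deriv (fun s : ℝ => f ((s : Circ), r)) t := by
    unfold pdTheta
    have := deriv_comp_const_add (fun s : ℝ => f ((s : Circ), r)) t 0
    simpa using this
  rw [h2, h.deriv]

lemma pdR_eq_of_hasDerivAt {f : Cyl → ℝ} {θ : Circ} {r a : ℝ}
    (h : HasDerivAt (fun s : ℝ => f (θ, s)) a r) : pdR f (θ, r) = a := h.deriv

/-- The trigonometric function `θ ↦ Re (w e^{inθ})`. -/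
noncomputable def trig (w : ℂ) (n : ℤ) (θ : Circ) : ℝ := (w * fourier n θ).re

lemma continuous_trig (w : ℂ) (n : ℤ) : Continuous (trig w n) := by
  unfold trig; fun_prop

lemma trig_coe (w : ℂ) (n : ℤ) (t : ℝ) :
    trig w n (t : Circ) = (w * Complex.exp (Complex.I * n * t)).re := by
  unfold trig
  rw [fourier_coe_apply]
  congr 3
  have : (Real.pi : ℂ) ≠ 0 := by exact_mod_cast Real.pi_ne_zero
  push_cast
  field_simp

/-- A complex amplitude keeps the family closed under ∂_θ, which multiplies the amplitude by in.
Sines and cosines need no separate treatment. -/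
lemma hasDerivAt_trig (w : ℂ) (n : ℤ) (t : ℝ) :
    HasDerivAt (fun s : ℝ => trig w n (s : Circ)) (trig (Complex.I * n * w) n (t : Circ)) t := by
  simp only [trig_coe]
  have h1 : HasDerivAt (fun s : ℝ => Complex.I * n * (s : ℂ)) (Complex.I * n) t := by
    simpa using (Complex.ofRealCLM.hasDerivAt (x := t)).const_mul (Complex.I * n)
  have h2 := (h1.cexp.const_mul w)
  have h3 := Complex.reCLM.hasFDerivAt.comp_hasDerivAt t h2
  refine h3.congr_deriv ?_
  rw [Complex.reCLM_apply]
  congr 1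
  ring

lemma contDiff_trig (w : ℂ) (n : ℤ) : ContDiff ℝ ∞ (fun s : ℝ => trig w n (s : Circ)) := by
  simp only [trig_coe]
  refine Complex.reCLM.contDiff.comp (contDiff_const.mul ?_)
  exact (contDiff_const.mul Complex.ofRealCLM.contDiff).cexp

lemma trig_smul (c : ℝ) (w : ℂ) (n : ℤ) (θ : Circ) : trig (c * w) n θ = c * trig w n θ := by
  simp only [trig]
  rw [mul_assoc, Complex.re_ofReal_mul]

/-- The function `(θ, r) ↦ Re (w e^{inθ}) g(r)`. -/
noncomputable def tensor (w : ℂ) (n : ℤ) (g : ℝ → ℝ) (z : Cyl) : ℝ := trig w n z.1 * g z.2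

lemma isSmooth_tensor (w : ℂ) (n : ℤ) {g : ℝ → ℝ} (hg : ContDiff ℝ ∞ g) :
    IsSmooth (tensor w n g) := by
  unfold IsSmooth tensor
  exact ((contDiff_trig w n).comp contDiff_fst).mul (hg.comp contDiff_snd)

lemma continuous_tensor (w : ℂ) (n : ℤ) {g : ℝ → ℝ} (hg : Continuous g) :
    Continuous (tensor w n g) := by
  unfold tensor
  exact ((continuous_trig w n).comp continuous_fst).mul (hg.comp continuous_snd)

lemma pdTheta_tensor (w : ℂ) (n : ℤ) (g : ℝ → ℝ) :
    pdTheta (tensor w n g) = tensor (Complex.I * n * w) n g := by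
  funext ⟨θ, r⟩
  obtain ⟨t, rfl⟩ := QuotientAddGroup.mk_surjective θ
  exact pdTheta_eq_of_hasDerivAt ((hasDerivAt_trig w n t).mul_const (g r))

lemma pdR_tensor (w : ℂ) (n : ℤ) {g : ℝ → ℝ} (hg : Differentiable ℝ g) :
    pdR (tensor w n g) = tensor w n (deriv g) := by
  funext ⟨θ, r⟩
  exact pdR_eq_of_hasDerivAt (f := tensor w n g) ((hg r).hasDerivAt.const_mul (trig w n θ))

/-! ### Differentiation rules for sums, products and functions of r alone. -/

lemma IsSmooth.zero : IsSmooth 0 := contDiff_const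

lemma IsSmooth.sum {ι : Type*} {s : Finset ι} {f : ι → Cyl → ℝ} (h : ∀ i ∈ s, IsSmooth (f i)) :
    IsSmooth (∑ i ∈ s, f i) := by
  unfold IsSmooth
  simp only [Finset.sum_apply]
  exact ContDiff.sum h

lemma pdTheta_sum {ι : Type*} {s : Finset ι} {f : ι → Cyl → ℝ} (h : ∀ i ∈ s, IsSmooth (f i)) :
    pdTheta (∑ i ∈ s, f i) = ∑ i ∈ s, pdTheta (f i) := by
  funext ⟨θ, r⟩
  obtain ⟨t, rfl⟩ := QuotientAddGroup.mk_surjective θ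
  simp only [Finset.sum_apply]
  refine pdTheta_eq_of_hasDerivAt ?_
  simp only [Finset.sum_apply]
  exact HasDerivAt.fun_sum fun i hi => (h i hi).hasDerivAt_theta t r

lemma pdR_sum {ι : Type*} {s : Finset ι} {f : ι → Cyl → ℝ} (h : ∀ i ∈ s, IsSmooth (f i)) :
    pdR (∑ i ∈ s, f i) = ∑ i ∈ s, pdR (f i) := by
  funext ⟨θ, r⟩
  simp only [Finset.sum_apply]
  refine pdR_eq_of_hasDerivAt ?_
  simp only [Finset.sum_apply]
  exact HasDerivAt.fun_sum fun i hi => (h i hi).hasDerivAt_r θ r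

lemma pdTheta_mul {f g : Cyl → ℝ} (hf : IsSmooth f) (hg : IsSmooth g) :
    pdTheta (f * g) = pdTheta f * g + f * pdTheta g := by
  funext ⟨θ, r⟩
  obtain ⟨t, rfl⟩ := QuotientAddGroup.mk_surjective θ
  exact pdTheta_eq_of_hasDerivAt ((hf.hasDerivAt_theta t r).mul (hg.hasDerivAt_theta t r))

lemma pdR_mul {f g : Cyl → ℝ} (hf : IsSmooth f) (hg : IsSmooth g) :
    pdR (f * g) = pdR f * g + f * pdR g := by
  funext ⟨θ, r⟩
  exact pdR_eq_of_hasDerivAt ((hf.hasDerivAt_r θ r).mul (hg.hasDerivAt_r θ r))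

/-- The function `(θ, r) ↦ g(r)`. -/
def radial (g : ℝ → ℝ) (z : Cyl) : ℝ := g z.2

lemma isSmooth_radial {g : ℝ → ℝ} (hg : ContDiff ℝ ∞ g) : IsSmooth (radial g) :=
  hg.comp contDiff_snd

lemma pdTheta_radial (g : ℝ → ℝ) : pdTheta (radial g) = 0 := by
  funext z
  simp [pdTheta, radial]

lemma pdR_radial (g : ℝ → ℝ) : pdR (radial g) = radial (deriv g) := rfl

/-! ### Cutoff functions -/

lemma contDiff_smoothTransition : ContDiff ℝ ∞ Real.smoothTransition :=
  Real.smoothTransition.contDiff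

lemma deriv_smoothTransition_of_neg {x : ℝ} (hx : x < 0) : deriv Real.smoothTransition x = 0 := by
  have : Real.smoothTransition =ᶠ[nhds x] fun _ => (0 : ℝ) := by
    filter_upwards [gt_mem_nhds hx] with y hy using Real.smoothTransition.zero_of_nonpos hy.le
  rw [this.deriv_eq, deriv_const]

lemma deriv_smoothTransition_of_one_lt {x : ℝ} (hx : 1 < x) :
    deriv Real.smoothTransition x = 0 := by
  have : Real.smoothTransition =ᶠ[nhds x] fun _ => (1 : ℝ) := by
    filter_upwards [lt_mem_nhds hx] with y hy using Real.smoothTransition.one_of_one_le hy.le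
  rw [this.deriv_eq, deriv_const]

lemma exists_bound_deriv_smoothTransition :
    ∃ C, 0 ≤ C ∧ ∀ x, |deriv Real.smoothTransition x| ≤ C := by
  have hc : Continuous (deriv Real.smoothTransition) :=
    contDiff_smoothTransition.continuous_deriv (by simp)
  obtain ⟨C, hC⟩ := (isCompact_Icc (a := (0 : ℝ)) (b := 1)).exists_bound_of_continuousOn
    hc.continuousOn
  have h0 : 0 ≤ C := (norm_nonneg _).trans (hC 0 (by simp))
  refine ⟨C, h0, fun x => ?_⟩
  rcases lt_or_ge x 0 with h | h
  · rwa [deriv_smoothTransition_of_neg h, abs_zero]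
  rcases lt_or_ge 1 x with h' | h'
  · rwa [deriv_smoothTransition_of_one_lt h', abs_zero]
  exact hC x ⟨h, h'⟩

/-- A smooth cutoff that vanishes for `r ≤ ε` and is `1` for `r ≥ 2ε`. -/
noncomputable def lowerCut (ε r : ℝ) : ℝ := Real.smoothTransition (r / ε - 1)

/-- A smooth cutoff that is `1` for `r ≤ 1 - δ` and vanishes for `r ≥ 1 - δ / 2`. -/
noncomputable def upperCut (δ r : ℝ) : ℝ := Real.smoothTransition ((1 - δ / 2 - r) * (2 / δ))

lemma contDiff_lowerCut (ε : ℝ) : ContDiff ℝ ∞ (lowerCut ε) :=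
  contDiff_smoothTransition.comp (by fun_prop)

lemma contDiff_upperCut (δ : ℝ) : ContDiff ℝ ∞ (upperCut δ) :=
  contDiff_smoothTransition.comp (by fun_prop)

lemma lowerCut_eq_zero {ε r : ℝ} (hε : 0 < ε) (h : r ≤ ε) : lowerCut ε r = 0 := by
  refine Real.smoothTransition.zero_of_nonpos ?_
  have := (div_le_one hε).2 h
  linarith

lemma lowerCut_eq_one {ε r : ℝ} (hε : 0 < ε) (h : 2 * ε ≤ r) : lowerCut ε r = 1 := by
  refine Real.smoothTransition.one_of_one_le ?_
  have := (le_div_iff₀ hε).2 h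
  linarith

lemma abs_lowerCut_le (ε r : ℝ) : |lowerCut ε r| ≤ 1 := by
  rw [lowerCut, abs_of_nonneg (Real.smoothTransition.nonneg _)]
  exact Real.smoothTransition.le_one _

lemma deriv_lowerCut (ε r : ℝ) :
    deriv (lowerCut ε) r = deriv Real.smoothTransition (r / ε - 1) / ε := by
  have h1 : HasDerivAt (fun s : ℝ => s / ε - 1) (1 / ε) r :=
    ((hasDerivAt_id r).div_const ε).sub_const 1
  have h2 : HasDerivAt Real.smoothTransition (deriv Real.smoothTransition (r / ε - 1))
      (r / ε - 1) :=
    (contDiff_smoothTransition.differentiable (by simp) _).hasDerivAt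
  have h3 := h2.comp r h1
  rw [mul_one_div] at h3
  exact h3.deriv

lemma deriv_lowerCut_eq_zero {ε r : ℝ} (hε : 0 < ε) (h : 2 * ε < r) :
    deriv (lowerCut ε) r = 0 := by
  rw [deriv_lowerCut, deriv_smoothTransition_of_one_lt, zero_div]
  have := (lt_div_iff₀ hε).2 h
  linarith

lemma upperCut_eq_zero {δ r : ℝ} (hδ : 0 < δ) (h : 1 - δ / 2 ≤ r) : upperCut δ r = 0 := by
  refine Real.smoothTransition.zero_of_nonpos ?_
  exact mul_nonpos_of_nonpos_of_nonneg (by linarith) (by positivity)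

lemma upperCut_eq_one {δ r : ℝ} (hδ : 0 < δ) (h : r ≤ 1 - δ) : upperCut δ r = 1 := by
  refine Real.smoothTransition.one_of_one_le ?_
  rw [mul_div_assoc', one_le_div hδ]
  linarith

/-! ### Fields with finite weighted energy have no flux through `Γ*` -/

lemma pdTheta_congr {f g : Cyl → ℝ} (h : EqOn f g Om) {z : Cyl} (hz : z ∈ Om) :
    pdTheta f z = pdTheta g z := by
  unfold pdTheta
  congr 1
  funext t
  exact h ⟨mem_univ _, hz.2⟩

lemma pdR_congr {f g : Cyl → ℝ} (h : EqOn f g Om) {z : Cyl} (hz : z ∈ Om) :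
    pdR f z = pdR g z := by
  unfold pdR
  refine Filter.EventuallyEq.deriv_eq ?_
  filter_upwards [isOpen_Ioo.mem_nhds hz.2] with r hr using h ⟨mem_univ _, hr⟩

/-- The weak divergence can be tested only with functions supported inside Ω. The cutoff removes the
strip r ≤ ε and leaves support in ε ≤ r ≤ 1 - δ. -/
lemma isTest_mul_lowerCut {φ : Cyl → ℝ} (hφ : IsSmooth φ) {δ : ℝ} (hδ : 0 < δ)
    (h0 : ∀ θ r, 1 - δ ≤ r → φ (θ, r) = 0) {ε : ℝ} (hε : 0 < ε) :
    IsTest (φ * radial (lowerCut ε)) := by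
  have hsub : tsupport (φ * radial (lowerCut ε)) ⊆ univ ×ˢ Icc ε (1 - δ) := by
    refine closure_minimal ?_ (isClosed_univ.prod isClosed_Icc)
    rintro ⟨θ, r⟩ hz
    refine ⟨mem_univ _, ?_⟩
    by_contra hr
    refine hz ?_
    rcases lt_or_ge r ε with h | h
    · simp [radial, lowerCut_eq_zero hε h.le]
    · have : 1 - δ ≤ r := by
        by_contra h'
        exact hr ⟨h, (not_le.1 h').le⟩
      simp [h0 θ r this]
  refine ⟨hφ.mul (isSmooth_radial (contDiff_lowerCut ε)), ?_, hsub.trans ?_⟩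
  · exact (isCompact_univ.prod isCompact_Icc).of_isClosed_subset (isClosed_tsupport _) hsub
  · refine prod_mono_right fun r hr => ⟨hε.trans_le hr.1, by linarith [hr.2]⟩

lemma memLp_weighted {α : ℝ} {u₁ u₂ : Cyl → ℝ} (h₂ : AEStronglyMeasurable u₂ muOm)
    (hfin : ∫⁻ z, ENNReal.ofReal (u₁ z ^ 2 + z.2 ^ (-α) * u₂ z ^ 2) ∂muOm < ⊤) :
    MemLp (fun z => z.2 ^ (-(α / 2)) * u₂ z) 2 muOm := by
  have hm : Measurable fun z : Cyl => z.2 ^ (-(α / 2)) := measurable_snd.pow_const _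
  have hm' : AEStronglyMeasurable (fun z : Cyl => z.2 ^ (-(α / 2)) * u₂ z) muOm :=
    hm.aestronglyMeasurable.mul h₂
  rw [memLp_two_iff_integrable_sq hm']
  refine ⟨hm'.pow 2, ?_⟩
  refine lt_of_le_of_lt (lintegral_mono_ae ?_) hfin
  filter_upwards [ae_mem_Om] with z hz
  rw [Real.enorm_eq_ofReal (sq_nonneg _)]
  refine ENNReal.ofReal_le_ofReal ?_
  have : (z.2 ^ (-(α / 2)) : ℝ) ^ 2 = z.2 ^ (-α) := by
    rw [← Real.rpow_natCast, ← Real.rpow_mul hz.2.1.le]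
    congr 1
    push_cast
    ring
  rw [mul_pow, this]
  linarith [sq_nonneg (u₁ z)]

lemma measureReal_strip_le {s : ℝ} (hs : 0 ≤ s) :
    muOm.real (univ ×ˢ Iic s) ≤ 2 * Real.pi * s := by
  have h1 : muOm (univ ×ˢ Iic s) ≤ ENNReal.ofReal (2 * Real.pi) * ENNReal.ofReal s := by
    rw [muOm_eq_prod, Measure.prod_prod, AddCircle.measure_univ]
    refine mul_le_mul_right ?_ _
    rw [Measure.restrict_apply measurableSet_Iic]
    refine (measure_mono (t := Icc 0 s) fun r hr => ⟨hr.2.1.le, hr.1⟩).trans ?_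
    simp
  rw [← ENNReal.ofReal_mul Real.two_pi_pos.le] at h1
  exact ENNReal.toReal_le_of_le_ofReal (by have := Real.pi_pos; positivity) h1

/-- The critical estimate. Write G = r^{-α/2} u₂. On the strip r ≤ 2ε, outside which the cutoff is
constant, |u₂| = r^{α/2} |G| ≤ √(2ε) |G| because α ≥ 1 and r < 1. The cutoff has slope at most C/ε
and the strip has area at most 4πε. The powers of ε cancel in Cauchy–Schwarz, which leaves a
constant times the norm of G on a shrinking strip. -/
lemma abs_flux_cutoff_le {α : ℝ} (hα : 1 ≤ α) {u₂ φ : Cyl → ℝ} {M C ε : ℝ} (hM0 : 0 ≤ M)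
    (hC0 : 0 ≤ C)
    (hG : MemLp (fun z => z.2 ^ (-(α / 2)) * u₂ z) 2 muOm) (hM : ∀ᵐ z ∂muOm, ‖φ z‖ ≤ M)
    (hC : ∀ x, |deriv Real.smoothTransition x| ≤ C) (hε : 0 < ε) :
    |∫ z, u₂ z * (φ z * deriv (lowerCut ε) z.2) ∂muOm| ≤
      √(∫ z, (indicator (univ ×ˢ Iic (2 * ε)) (fun z => z.2 ^ (-(α / 2)) * u₂ z) z) ^ 2 ∂muOm) *
        √(8 * Real.pi * M ^ 2 * C ^ 2) := by
  set S : Set Cyl := univ ×ˢ Iic (2 * ε) with hS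
  have hSm : MeasurableSet S := MeasurableSet.univ.prod measurableSet_Iic
  set G : Cyl → ℝ := fun z => z.2 ^ (-(α / 2)) * u₂ z with hGdef
  set c : ℝ := M * C * √(2 * ε) / ε with hc
  have hc0 : 0 ≤ c := by positivity
  have hGS : MemLp (S.indicator G) 2 muOm := hG.indicator hSm
  have hcS : MemLp (S.indicator fun _ => c) 2 muOm := (memLp_const c).indicator hSm
  have hGS' : MemLp (fun z => |S.indicator G z|) 2 muOm := hGS.abs
  have hpt : ∀ᵐ z ∂muOm, |u₂ z * (φ z * deriv (lowerCut ε) z.2)| ≤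
      |S.indicator G z| * S.indicator (fun _ => c) z := by
    filter_upwards [ae_mem_Om, hM] with z hz hMz
    by_cases hzS : z ∈ S
    · rw [indicator_of_mem hzS, indicator_of_mem hzS, abs_mul, abs_mul]
      have hr : 0 < z.2 := hz.2.1
      have e1 : |u₂ z| = |G z| * z.2 ^ (α / 2) := by
        have h0 : 0 < z.2 ^ (α / 2) := Real.rpow_pos_of_pos hr _
        simp only [hGdef]
        rw [abs_mul, Real.rpow_neg hr.le, abs_of_pos (inv_pos.2 h0)]
        field_simp
      have e2 : z.2 ^ (α / 2) ≤ √(2 * ε) := by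
        refine (Real.rpow_le_rpow_of_exponent_ge hr hz.2.2.le
          (by linarith : (1 / 2 : ℝ) ≤ α / 2)).trans ?_
        rw [← Real.sqrt_eq_rpow]
        exact Real.sqrt_le_sqrt hzS.2
      have e3 : |deriv (lowerCut ε) z.2| ≤ C / ε := by
        rw [deriv_lowerCut, abs_div, abs_of_pos hε]
        gcongr
        exact hC _
      rw [Real.norm_eq_abs] at hMz
      rw [e1, mul_assoc]
      refine mul_le_mul_of_nonneg_left ?_ (abs_nonneg _)
      calc z.2 ^ (α / 2) * (|φ z| * |deriv (lowerCut ε) z.2|)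
          ≤ √(2 * ε) * (M * (C / ε)) := by gcongr
        _ = c := by rw [hc]; ring
    · have hr : 2 * ε < z.2 := by
        by_contra h
        exact hzS ⟨mem_univ _, not_lt.1 h⟩
      rw [deriv_lowerCut_eq_zero hε hr]
      simp [hzS]
  have hint : Integrable (fun z => |S.indicator G z| * S.indicator (fun _ => c) z) muOm :=
    hGS'.integrable_mul hcS
  have hcI : ∫ z, (S.indicator (fun _ => c) z) ^ 2 ∂muOm ≤ 8 * Real.pi * M ^ 2 * C ^ 2 := by
    have : (fun z => (S.indicator (fun _ => c) z) ^ 2) = S.indicator (fun _ => c ^ 2) := by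
      funext z
      by_cases h : z ∈ S <;> simp [h]
    rw [this, integral_indicator hSm, setIntegral_const, smul_eq_mul]
    -- The area 4πε of the strip meets c² = 2M²C²/ε, so the bound does not depend on ε.
    calc muOm.real S * c ^ 2 ≤ (2 * Real.pi * (2 * ε)) * c ^ 2 := by
          gcongr
          exact measureReal_strip_le (by positivity)
      _ = 8 * Real.pi * M ^ 2 * C ^ 2 := by
          rw [hc, div_pow, mul_pow, Real.sq_sqrt (by positivity)]
          field_simp
          ring
  calc |∫ z, u₂ z * (φ z * deriv (lowerCut ε) z.2) ∂muOm|
      ≤ ∫ z, |S.indicator G z| * S.indicator (fun _ => c) z ∂muOm :=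
        (Real.norm_eq_abs _).symm.le.trans (norm_integral_le_of_norm_le hint hpt)
    _ ≤ √(∫ z, |S.indicator G z| ^ 2 ∂muOm) * √(∫ z, (S.indicator (fun _ => c) z) ^ 2 ∂muOm) :=
        (le_abs_self _).trans (abs_integral_mul_le hGS' hcS)
    _ ≤ _ := by
        simp only [sq_abs]
        gcongr

/-- With ε = 1/(k+1), every fixed height r > 0 eventually leaves the strip r ≤ 2ε. This gives the
pointwise limits needed for dominated convergence. -/
lemma tendsto_lowerCut {r : ℝ} (hr : 0 < r) :
    ∀ᶠ k : ℕ in Filter.atTop, 2 * (1 / ((k : ℝ) + 1)) < r := by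
  have : Filter.Tendsto (fun k : ℕ => 2 * (1 / ((k : ℝ) + 1))) Filter.atTop (nhds (2 * 0)) :=
    tendsto_one_div_add_atTop_nhds_zero_nat.const_mul 2
  rw [mul_zero] at this
  exact this.eventually (gt_mem_nhds hr)

lemma tendsto_integral_strip {G : Cyl → ℝ} (hG : MemLp G 2 muOm) :
    Filter.Tendsto (fun k : ℕ => ∫ z, ((univ ×ˢ Iic (2 * (1 / ((k : ℝ) + 1)))).indicator G z) ^ 2
      ∂muOm) Filter.atTop (nhds 0) := by
  rw [← integral_zero Cyl ℝ (μ := muOm)]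
  refine tendsto_integral_of_dominated_convergence (fun z => G z ^ 2) (fun k => ?_)
    hG.integrable_sq (fun k => ?_) ?_
  · exact ((hG.indicator (MeasurableSet.univ.prod measurableSet_Iic)).aestronglyMeasurable).pow 2
  · refine Filter.Eventually.of_forall fun z => ?_
    rw [Real.norm_eq_abs, abs_of_nonneg (sq_nonneg _)]
    by_cases h : z ∈ (univ ×ˢ Iic (2 * (1 / ((k : ℝ) + 1))) : Set Cyl)
    · rw [indicator_of_mem h]
    · rw [indicator_of_notMem h, zero_pow two_ne_zero]
      positivity
  · filter_upwards [ae_mem_Om] with z hz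
    refine tendsto_const_nhds.congr' ?_
    filter_upwards [tendsto_lowerCut hz.2.1] with k hk
    rw [indicator_of_notMem, zero_pow two_ne_zero]
    exact fun h => absurd h.2 (not_le.2 hk)

/-- Testing the weak divergence with φ χ_ε gives ∫ P χ_ε = -∫ u₂ φ χ_ε', where P is the integrand of
the claim. As ε → 0 the left side tends to ∫ P by dominated convergence and the right side to 0 by
`abs_flux_cutoff_le`. -/
lemma weighted_green_of_eq_zero {α : ℝ} (hα : 1 ≤ α) {u₁ u₂ d : Cyl → ℝ} (h₁ : MemLp u₁ 2 muOm)
    (h₂ : MemLp u₂ 2 muOm) (hd : MemLp d 2 muOm) (hw : IsWeakDiv u₁ u₂ d)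
    (hG : MemLp (fun z => z.2 ^ (-(α / 2)) * u₂ z) 2 muOm) {φ : Cyl → ℝ} (hφ : IsSmooth φ)
    {δ : ℝ} (hδ : 0 < δ) (h0 : ∀ θ r, 1 - δ ≤ r → φ (θ, r) = 0) :
    ∫ z, (u₁ z * pdTheta φ z + u₂ z * pdR φ z + d z * φ z) ∂muOm = 0 := by
  set P : Cyl → ℝ := fun z => u₁ z * pdTheta φ z + u₂ z * pdR φ z + d z * φ z with hP
  set Q : ℕ → Cyl → ℝ := fun k z => u₂ z * (φ z * deriv (lowerCut (1 / ((k : ℝ) + 1))) z.2) with hQ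
  have hPi : Integrable P muOm :=
    ((integrable_mul_of_memLp h₁ hφ.pdTheta.continuous).add
      (integrable_mul_of_memLp h₂ hφ.pdR.continuous)).add
      (integrable_mul_of_memLp hd hφ.continuous)
  have hεp : ∀ k : ℕ, (0 : ℝ) < 1 / ((k : ℝ) + 1) := fun k => Nat.one_div_pos_of_nat
  have hcut : ∀ ε, Continuous (lowerCut ε) := fun ε => (contDiff_lowerCut ε).continuous
  have hcut' : ∀ ε, Continuous (deriv (lowerCut ε)) := fun ε =>
    (contDiff_lowerCut ε).continuous_deriv (by simp)
  have hQi : ∀ k, Integrable (Q k) muOm := fun k =>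
    integrable_mul_of_memLp h₂ (hφ.continuous.mul ((hcut' _).comp continuous_snd))
  have hPc : ∀ k : ℕ, Integrable (fun z => P z * lowerCut (1 / ((k : ℝ) + 1)) z.2) muOm := by
    intro k
    refine hPi.mul_bdd (c := 1) ((hcut _).comp continuous_snd).aestronglyMeasurable ?_
    exact Filter.Eventually.of_forall fun z => abs_lowerCut_le _ _
  have key : ∀ k : ℕ, ∫ z, P z * lowerCut (1 / ((k : ℝ) + 1)) z.2 ∂muOm = -∫ z, Q k z ∂muOm := by
    intro k
    have ht := isTest_mul_lowerCut hφ hδ h0 (hεp k)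
    have h := hw _ ht
    rw [pdTheta_mul hφ (isSmooth_radial (contDiff_lowerCut _)),
      pdR_mul hφ (isSmooth_radial (contDiff_lowerCut _)), pdTheta_radial, pdR_radial] at h
    rw [eq_neg_iff_add_eq_zero, ← integral_add] at h ⊢
    · rw [← h]
      refine integral_congr_ae (Filter.Eventually.of_forall fun z => ?_)
      simp only [hP, hQ, Pi.add_apply, Pi.mul_apply, radial, Pi.zero_apply]
      ring
    · exact hPc k
    · exact hQi k
    · refine (integrable_mul_of_memLp h₁ ?_).add (integrable_mul_of_memLp h₂ ?_)
      · exact (hφ.pdTheta.continuous.mul ((hcut _).comp continuous_snd)).add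
          (hφ.continuous.mul continuous_const)
      · exact (hφ.pdR.continuous.mul ((hcut _).comp continuous_snd)).add
          (hφ.continuous.mul ((hcut' _).comp continuous_snd))
    · exact integrable_mul_of_memLp hd (hφ.continuous.mul ((hcut _).comp continuous_snd))
  obtain ⟨C, hC0, hC⟩ := exists_bound_deriv_smoothTransition
  obtain ⟨M', hM'⟩ := exists_bound hφ.continuous
  have hM : ∀ᵐ z ∂muOm, ‖φ z‖ ≤ max M' 0 := by
    filter_upwards [hM'] with z hz using hz.trans (le_max_left _ _)
  have hQ0 : Filter.Tendsto (fun k => ∫ z, Q k z ∂muOm) Filter.atTop (nhds 0) := by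
    refine squeeze_zero_norm (fun k => abs_flux_cutoff_le hα (le_max_right _ _) hC0 hG hM hC (hεp k)) ?_
    have h := (Real.continuous_sqrt.tendsto _).comp (tendsto_integral_strip hG)
    rw [Real.sqrt_zero] at h
    simpa using h.mul_const (√(8 * Real.pi * (max M' 0) ^ 2 * C ^ 2))
  have hPl : Filter.Tendsto (fun k : ℕ => ∫ z, P z * lowerCut (1 / ((k : ℝ) + 1)) z.2 ∂muOm)
      Filter.atTop (nhds (∫ z, P z ∂muOm)) := by
    refine tendsto_integral_of_dominated_convergence (fun z => ‖P z‖)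
      (fun k => (hPc k).aestronglyMeasurable) hPi.norm (fun k => ?_) ?_
    · refine Filter.Eventually.of_forall fun z => ?_
      rw [norm_mul]
      exact mul_le_of_le_one_right (norm_nonneg _) (abs_lowerCut_le _ _)
    · filter_upwards [ae_mem_Om] with z hz
      refine tendsto_const_nhds.congr' ?_
      filter_upwards [tendsto_lowerCut hz.2.1] with k hk
      rw [lowerCut_eq_one (hεp k) hk.le, mul_one]
  simp only [key] at hPl
  have := tendsto_nhds_unique hPl hQ0.neg
  rw [this, neg_zero]

/-- If `𝐮 ∈ H(div, Ω; w⁻¹)`, Green's formula holds without a boundary term for test functions that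
vanish near `Γ`, whatever their values on `Γ*`. -/
lemma weighted_green {α : ℝ} (hα : 1 ≤ α) {u₁ u₂ d : Cyl → ℝ} (h₁ : MemLp u₁ 2 muOm)
    (h₂ : MemLp u₂ 2 muOm) (hd : MemLp d 2 muOm) (hw : IsWeakDiv u₁ u₂ d)
    (hG : MemLp (fun z => z.2 ^ (-(α / 2)) * u₂ z) 2 muOm) {φ : Cyl → ℝ} (hφ : IsSmoothGamma φ) :
    ∫ z, (u₁ z * pdTheta φ z + u₂ z * pdR φ z + d z * φ z) ∂muOm = 0 := by
  obtain ⟨δ, hδ, hs⟩ := hφ.supp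
  -- `IsSmoothGamma` says nothing about φ for r > 1. The upper cutoff makes φ vanish there too and
  -- leaves it unchanged on Ω.
  have hψ : IsSmooth (φ * radial (upperCut δ)) :=
    hφ.smooth.mul (isSmooth_radial (contDiff_upperCut δ))
  have heq : EqOn φ (φ * radial (upperCut δ)) Om := by
    rintro ⟨θ, r⟩ hz
    rcases le_total r (1 - δ) with h | h
    · simp [radial, upperCut_eq_one hδ h]
    · simp [hs θ r ⟨hz.2.1.le, hz.2.2.le⟩ h]
  rw [← weighted_green_of_eq_zero hα h₁ h₂ hd hw hG hψ (half_pos hδ) fun θ r hr => by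
    simp [radial, upperCut_eq_zero hδ hr]]
  refine integral_congr_ae ?_
  filter_upwards [ae_mem_Om] with z hz
  rw [pdTheta_congr heq hz, pdR_congr heq hz, heq hz]

/-! ### Green's formula in `H²(Ω; w)` -/

lemma integral_sq_le_of_lintegral_lt {f g : Cyl → ℝ} {ε : ℝ} (hε : 0 < ε) (hf : MemLp f 2 muOm)
    (hfg : ∀ᵐ z ∂muOm, f z ^ 2 ≤ g z) (h : ∫⁻ z, ENNReal.ofReal (g z) ∂muOm < ENNReal.ofReal ε) :
    ∫ z, f z ^ 2 ∂muOm ≤ ε := by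
  rw [integral_eq_lintegral_of_nonneg_ae (Filter.Eventually.of_forall fun z => sq_nonneg _)
    (hf.aestronglyMeasurable.pow 2)]
  refine ENNReal.toReal_le_of_le_ofReal hε.le ?_
  refine (lintegral_mono_ae ?_).trans h.le
  filter_upwards [hfg] with z hz using ENNReal.ofReal_le_ofReal hz

lemma rpow_half_mul_self {α r : ℝ} (hr : 0 < r) : r ^ (α / 2) * r ^ (α / 2) = r ^ α := by
  rw [← Real.rpow_add hr, add_halves]

/-- Since r^{-α/2} r^α = r^{α/2}, the weighted flux is the finite energy of u itself. -/
lemma H2w.memLp_weighted_flux {α : ℝ} (u : H2w α) :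
    MemLp (fun z => z.2 ^ (-(α / 2)) * (z.2 ^ α * u.dr z)) 2 muOm := by
  refine (memLp_congr_ae ?_).1 u.memLp_dr
  filter_upwards [ae_mem_Om] with z hz
  rw [← mul_assoc, ← Real.rpow_add hz.2.1]
  congr 2
  ring

/-- The defect D of the identity is linear in v, bounded in the energy norm, and zero for smooth φ
vanishing near Γ by `weighted_green`. Such φ approximate v in that norm. -/
lemma H2w.green {α : ℝ} (hα : 1 ≤ α) (u : H2w α) {v : H1w α} (hv : v ∈ H1wGamma α) :
    -∫ z, u.divA z * v.val z ∂muOm =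
      ∫ z, (v.dtheta z * u.dtheta z + v.dr z * (z.2 ^ α * u.dr z)) ∂muOm := by
  have hα0 : 0 ≤ α := zero_le_one.trans hα
  have hwm : Measurable fun z : Cyl => z.2 ^ (α / 2) := measurable_snd.pow_const _
  -- Splitting r^α evenly gives each factor the weight r^{α/2} under which it is square-integrable.
  have hsplit : ∀ (f : Cyl → ℝ), (fun z => f z * (z.2 ^ α * u.dr z)) =ᵐ[muOm]
      fun z => (z.2 ^ (α / 2) * f z) * (z.2 ^ (α / 2) * u.dr z) := fun f => by
    filter_upwards [ae_mem_Om] with z hz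
    rw [← rpow_half_mul_self (α := α) hz.2.1]
    ring
  have i1 : Integrable (fun z => v.dtheta z * u.dtheta z) muOm :=
    v.memLp_dtheta.integrable_mul u.memLp_dtheta
  have i2 : Integrable (fun z => v.dr z * (z.2 ^ α * u.dr z)) muOm :=
    (integrable_congr (hsplit v.dr)).2 (v.memLp_dr.integrable_mul u.memLp_dr)
  have i3 : Integrable (fun z => u.divA z * v.val z) muOm := u.memLp_divA.integrable_mul v.memLp_val
  have i12 : Integrable (fun z => v.dtheta z * u.dtheta z + v.dr z * (z.2 ^ α * u.dr z)) muOm :=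
    i1.add i2
  set D : ℝ := ∫ z, (v.dtheta z * u.dtheta z + v.dr z * (z.2 ^ α * u.dr z)) ∂muOm +
    ∫ z, u.divA z * v.val z ∂muOm with hD
  set K : ℝ := √(∫ z, u.dtheta z ^ 2 ∂muOm) + √(∫ z, (z.2 ^ (α / 2) * u.dr z) ^ 2 ∂muOm) +
    √(∫ z, u.divA z ^ 2 ∂muOm) with hK
  have hbound : ∀ ε : ℝ, 0 < ε → |D| ≤ √ε * K := by
    intro ε hε
    obtain ⟨φ, hφ, hlt⟩ := hv (ENNReal.ofReal ε) (ENNReal.ofReal_pos.2 hε)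
    have hz0 := weighted_green hα u.memLp_dtheta (memLp_flux hα0 u.toH1w) u.memLp_divA u.weak_divA
      u.memLp_weighted_flux hφ
    have m1 : MemLp (fun z => v.dtheta z - pdTheta φ z) 2 muOm :=
      v.memLp_dtheta.sub (memLp_of_continuous hφ.smooth.pdTheta.continuous)
    have m0 : MemLp (fun z => v.val z - φ z) 2 muOm :=
      v.memLp_val.sub (memLp_of_continuous hφ.smooth.continuous)
    have m2' : MemLp (fun z : Cyl => z.2 ^ (α / 2) * pdR φ z) 2 muOm := by
      refine MemLp.of_le (memLp_of_continuous hφ.smooth.pdR.continuous)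
        (hwm.aestronglyMeasurable.mul hφ.smooth.pdR.continuous.aestronglyMeasurable) ?_
      filter_upwards [ae_mem_Om] with z hz
      rw [norm_mul, Real.norm_of_nonneg (Real.rpow_nonneg hz.2.1.le _)]
      exact mul_le_of_le_one_left (norm_nonneg _)
        (Real.rpow_le_one hz.2.1.le hz.2.2.le (by positivity))
    have m2 : MemLp (fun z => z.2 ^ (α / 2) * (v.dr z - pdR φ z)) 2 muOm := by
      simp only [mul_sub]
      exact v.memLp_dr.sub m2'
    have hw : ∀ z ∈ Om, (z.2 ^ (α / 2) * (v.dr z - pdR φ z)) ^ 2 =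
        z.2 ^ α * (v.dr z - pdR φ z) ^ 2 := by
      intro z hz
      rw [← rpow_half_mul_self (α := α) hz.2.1]
      ring
    have b0 := integral_sq_le_of_lintegral_lt hε m0 (by
      filter_upwards [ae_mem_Om] with z hz
      have := hw z hz
      nlinarith [sq_nonneg (v.dtheta z - pdTheta φ z),
        sq_nonneg (z.2 ^ (α / 2) * (v.dr z - pdR φ z))]) hlt
    have b1 := integral_sq_le_of_lintegral_lt hε m1 (by
      filter_upwards [ae_mem_Om] with z hz
      have := hw z hz
      nlinarith [sq_nonneg (v.val z - φ z),
        sq_nonneg (z.2 ^ (α / 2) * (v.dr z - pdR φ z))]) hlt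
    have b2 := integral_sq_le_of_lintegral_lt hε m2 (by
      filter_upwards [ae_mem_Om] with z hz
      have := hw z hz
      nlinarith [sq_nonneg (v.val z - φ z), sq_nonneg (v.dtheta z - pdTheta φ z)]) hlt
    have c1 := abs_integral_mul_le m1 u.memLp_dtheta
    have c2 := abs_integral_mul_le m2 u.memLp_dr
    have c3 := abs_integral_mul_le m0 u.memLp_divA
    have j1 : Integrable (fun z => (v.dtheta z - pdTheta φ z) * u.dtheta z) muOm :=
      m1.integrable_mul u.memLp_dtheta
    have j2 : Integrable (fun z => (z.2 ^ (α / 2) * (v.dr z - pdR φ z)) *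
        (z.2 ^ (α / 2) * u.dr z)) muOm := m2.integrable_mul u.memLp_dr
    have j3 : Integrable (fun z => (v.val z - φ z) * u.divA z) muOm :=
      m0.integrable_mul u.memLp_divA
    have j12 : Integrable (fun z => (v.dtheta z - pdTheta φ z) * u.dtheta z +
        (z.2 ^ (α / 2) * (v.dr z - pdR φ z)) * (z.2 ^ (α / 2) * u.dr z)) muOm := j1.add j2
    -- Subtracting the vanishing identity `hz0` for φ replaces v by v - φ throughout.
    have hDeq : D = ∫ z, (v.dtheta z - pdTheta φ z) * u.dtheta z ∂muOm +
        ∫ z, (z.2 ^ (α / 2) * (v.dr z - pdR φ z)) * (z.2 ^ (α / 2) * u.dr z) ∂muOm +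
        ∫ z, (v.val z - φ z) * u.divA z ∂muOm := by
      rw [hD, ← integral_add i12 i3, ← integral_add j1 j2,
        ← integral_add j12 j3, ← sub_zero (integral _ _), ← hz0, ← integral_sub]
      · refine integral_congr_ae ?_
        filter_upwards [ae_mem_Om] with z hz
        rw [← rpow_half_mul_self (α := α) hz.2.1]
        ring
      · exact i12.add i3
      · exact ((integrable_mul_of_memLp u.memLp_dtheta hφ.smooth.pdTheta.continuous).add
          (integrable_mul_of_memLp (memLp_flux hα0 u.toH1w) hφ.smooth.pdR.continuous)).add
          (integrable_mul_of_memLp u.memLp_divA hφ.smooth.continuous)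
    rw [hDeq]
    refine (abs_add_three _ _ _).trans ?_
    rw [hK, mul_add, mul_add]
    refine add_le_add (add_le_add (c1.trans ?_) (c2.trans ?_)) (c3.trans ?_) <;>
    · gcongr
  have hD0 : D = 0 := by
    have ht : Filter.Tendsto (fun ε : ℝ => √ε * K) (nhdsWithin 0 (Ioi 0)) (nhds (√0 * K)) :=
      ((Real.continuous_sqrt.mul continuous_const).tendsto 0).mono_left nhdsWithin_le_nhds
    rw [Real.sqrt_zero, zero_mul] at ht
    have : |D| ≤ 0 := ge_of_tendsto ht (by
      filter_upwards [self_mem_nhdsWithin] with ε hε using hbound ε hε)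
    exact abs_nonpos_iff.1 this
  linarith

/-! ### Weak derivatives on the interval `(0, 1)` -/

/-- Lebesgue measure on the interval `(0, 1)`. -/
noncomputable abbrev muI : Measure ℝ := (volume : Measure ℝ).restrict (Ioo 0 1)

lemma integral_muI (f : ℝ → ℝ) : ∫ r, f r ∂muI = ∫ r in (0 : ℝ)..1, f r := by
  rw [← integral_Ioc_eq_integral_Ioo, ← intervalIntegral.integral_of_le zero_le_one]

lemma intervalIntegrable_of_muI {f : ℝ → ℝ} (hf : Integrable f muI) :
    IntervalIntegrable f volume 0 1 := by
  rw [intervalIntegrable_iff_integrableOn_Ioo_of_le zero_le_one]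
  exact hf

lemma integrable_muI_of_continuous {f : ℝ → ℝ} (hf : Continuous f) : Integrable f muI :=
  (hf.integrableOn_Icc (a := 0) (b := 1)).mono_set Ioo_subset_Icc_self

lemma memLp_muI_of_continuous {f : ℝ → ℝ} (hf : Continuous f) : MemLp f 2 muI := by
  rw [memLp_two_iff_integrable_sq hf.aestronglyMeasurable]
  exact integrable_muI_of_continuous (hf.pow 2)

lemma exists_Icc_of_tsupport_subset {k : ℝ → ℝ} (hk : HasCompactSupport k)
    (hs : tsupport k ⊆ Ioo 0 1) :
    ∃ a b : ℝ, 0 < a ∧ a ≤ b ∧ b < 1 ∧ ∀ r, r ∉ Icc a b → k r = 0 := by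
  -- The point 1/2 only keeps the set nonempty when k = 0, so that its infimum and supremum are
  -- attained.
  set K : Set ℝ := insert (1 / 2) (tsupport k) with hK
  have hKc : IsCompact K := hk.isCompact.insert _
  have hKn : K.Nonempty := ⟨1 / 2, mem_insert _ _⟩
  have hKs : K ⊆ Ioo 0 1 := insert_subset (by norm_num) hs
  refine ⟨sInf K, sSup K, (hKs (hKc.sInf_mem hKn)).1,
    csInf_le_csSup hKn hKc.bddBelow hKc.bddAbove, (hKs (hKc.sSup_mem hKn)).2, fun r hr => ?_⟩
  refine image_eq_zero_of_notMem_tsupport fun h => hr ?_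
  exact ⟨csInf_le hKc.bddBelow (mem_insert_of_mem _ h), le_csSup hKc.bddAbove (mem_insert_of_mem _ h)⟩

lemma contDiff_primitive {k : ℝ → ℝ} (hk : ContDiff ℝ ∞ k) :
    ContDiff ℝ ∞ (fun r => ∫ s in (0 : ℝ)..r, k s) := by
  have hd : ∀ r, HasDerivAt (fun r => ∫ s in (0 : ℝ)..r, k s) (k r) r := fun r =>
    intervalIntegral.integral_hasDerivAt_right (hk.continuous.intervalIntegrable _ _)
      (hk.continuous.stronglyMeasurableAtFilter _ _) hk.continuous.continuousAt
  rw [contDiff_infty_iff_deriv]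
  refine ⟨fun r => (hd r).differentiableAt, ?_⟩
  rwa [funext fun r => (hd r).deriv]

/-- A test function on `(0, 1)` with vanishing integral is the derivative of a test function. -/
lemma exists_primitive_test {k : ℝ → ℝ} (hk : ContDiff ℝ ∞ k) (hc : HasCompactSupport k)
    (hs : tsupport k ⊆ Ioo 0 1) (h0 : ∫ r, k r ∂muI = 0) :
    ∃ ψ : ℝ → ℝ, ContDiff ℝ ∞ ψ ∧ HasCompactSupport ψ ∧ tsupport ψ ⊆ Ioo 0 1 ∧ deriv ψ = k := by
  obtain ⟨a, b, ha, hab, hb, hz⟩ := exists_Icc_of_tsupport_subset hc hs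
  have hii : ∀ x y, IntervalIntegrable k volume x y := fun x y =>
    hk.continuous.intervalIntegrable _ _
  have hsub : tsupport (fun r => ∫ s in (0 : ℝ)..r, k s) ⊆ Icc a b := by
    refine closure_minimal (fun r hr => ?_) isClosed_Icc
    by_contra hrab
    refine hr ?_
    rcases lt_or_ge r a with h | h
    · refine intervalIntegral.integral_zero_ae (Filter.Eventually.of_forall fun s hs => ?_)
      refine hz s fun h' => ?_
      have : s ≤ max 0 r := hs.2
      exact absurd (this.trans_lt (max_lt ha h)) (not_lt.2 h'.1)
    · have hbr : b < r := by
        by_contra h'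
        exact hrab ⟨h, not_lt.1 h'⟩
      -- Beyond b the primitive is constant, equal to the full integral of k, which is zero.
      have h1 : ∫ s in (1 : ℝ)..r, k s = 0 := by
        refine intervalIntegral.integral_zero_ae (Filter.Eventually.of_forall fun s hs => ?_)
        refine hz s fun h' => ?_
        have : min 1 r < s := hs.1
        exact absurd ((lt_min hb hbr).trans this) (not_lt.2 h'.2)
      change ∫ s in (0 : ℝ)..r, k s = 0
      rw [← intervalIntegral.integral_add_adjacent_intervals (hii 0 1) (hii 1 r), h1, add_zero,
        ← integral_muI, h0]
  refine ⟨fun r => ∫ s in (0 : ℝ)..r, k s, contDiff_primitive hk, ?_, hsub.trans fun r hr =>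
    ⟨ha.trans_le hr.1, hr.2.trans_lt hb⟩, ?_⟩
  · exact isCompact_Icc.of_isClosed_subset (isClosed_tsupport _) hsub
  · funext r
    exact (intervalIntegral.integral_hasDerivAt_right (hii _ _)
      (hk.continuous.stronglyMeasurableAtFilter _ _) hk.continuous.continuousAt).deriv

lemma ae_eq_zero_of_test {f : ℝ → ℝ} (hf : Integrable f muI)
    (h : ∀ g : ℝ → ℝ, ContDiff ℝ ∞ g → HasCompactSupport g → tsupport g ⊆ Ioo 0 1 →
      ∫ r, f r * g r ∂muI = 0) : f =ᵐ[muI] 0 := by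
  have := isOpen_Ioo.ae_eq_zero_of_integral_contDiff_smul_eq_zero (μ := muI) (f := f)
    (U := Ioo (0 : ℝ) 1) (hf.locallyIntegrable.locallyIntegrableOn _) fun g hg hc hs => by
      rw [← h g hg hc hs]
      simp only [smul_eq_mul, mul_comm]
  filter_upwards [this, ae_restrict_mem measurableSet_Ioo] with r hr hr' using hr hr'

/-- The lemma of du Bois-Reymond. -/
lemma exists_const_of_weak_deriv_zero {B : ℝ → ℝ} (hB : Integrable B muI)
    (h : ∀ ψ : ℝ → ℝ, ContDiff ℝ ∞ ψ → HasCompactSupport ψ → tsupport ψ ⊆ Ioo 0 1 →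
      ∫ r, B r * deriv ψ r ∂muI = 0) : ∃ c : ℝ, B =ᵐ[muI] fun _ => c := by
  -- A bump of unit mass supported in [1/4, 3/4]. The constant c below is the average of B against
  -- it.
  let β : ContDiffBump (1 / 2 : ℝ) := ⟨1 / 8, 1 / 4, by norm_num, by norm_num⟩
  set ρ : ℝ → ℝ := β.normed volume with hρ
  have hρs : ContDiff ℝ ∞ ρ := β.contDiff_normed
  have hρc : HasCompactSupport ρ := β.hasCompactSupport_normed
  have hρt : tsupport ρ ⊆ Ioo 0 1 := by
    rw [hρ, β.tsupport_normed_eq, Real.closedBall_eq_Icc]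
    intro r hr
    have h1 := hr.1
    have h2 := hr.2
    simp only [β] at h1 h2
    constructor <;> norm_num at h1 h2 ⊢ <;> linarith
  have hρ1 : ∫ r, ρ r ∂muI = 1 := by
    rw [← β.integral_normed (μ := volume)]
    refine setIntegral_eq_integral_of_forall_compl_eq_zero fun r hr => ?_
    exact image_eq_zero_of_notMem_tsupport fun h' => hr (hρt h')
  have hBm : ∀ {g : ℝ → ℝ}, Continuous g → HasCompactSupport g →
      Integrable (fun r => B r * g r) muI := fun {g} hg hgc => by
    obtain ⟨C, hC⟩ := hgc.exists_bound_of_continuous hg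
    exact hB.mul_bdd (c := C) hg.aestronglyMeasurable (Filter.Eventually.of_forall hC)
  set c := ∫ r, B r * ρ r ∂muI with hc
  refine ⟨c, ?_⟩
  have hz : (fun r => B r - c) =ᵐ[muI] 0 := by
    refine ae_eq_zero_of_test (hB.sub (integrable_const c)) fun g hg hgc hgs => ?_
    set I := ∫ r, g r ∂muI with hI
    have hgi : Integrable g muI := integrable_muI_of_continuous hg.continuous
    have hρi : Integrable ρ muI := integrable_muI_of_continuous hρs.continuous
    have hks : tsupport (fun r => g r - I * ρ r) ⊆ tsupport g ∪ tsupport ρ := by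
      refine closure_minimal (fun r hr => ?_) ((isClosed_tsupport _).union (isClosed_tsupport _))
      by_contra hn
      rw [mem_union, not_or] at hn
      refine hr ?_
      simp [image_eq_zero_of_notMem_tsupport hn.1, image_eq_zero_of_notMem_tsupport hn.2]
    -- Subtracting I ρ makes the mean of g zero, so the difference is the derivative of a test
    -- function and is annihilated by B.
    obtain ⟨ψ, hψ, hψc, hψs, hψd⟩ := exists_primitive_test (k := fun r => g r - I * ρ r)
      (hg.sub (contDiff_const.mul hρs))
      ((hgc.isCompact.union hρc.isCompact).of_isClosed_subset (isClosed_tsupport _) hks)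
      (hks.trans (union_subset hgs hρt)) (by
        rw [integral_sub hgi (hρi.const_mul I), integral_const_mul, hρ1, mul_one, sub_self])
    have h1 := h ψ hψ hψc hψs
    rw [hψd] at h1
    have e1 : ∫ r, B r * (g r - I * ρ r) ∂muI = ∫ r, B r * g r ∂muI - I * c := by
      rw [hc, ← integral_const_mul, ← integral_sub (hBm hg.continuous hgc)
        ((hBm hρs.continuous hρc).const_mul I)]
      congr 1
      funext r
      ring
    have e2 : ∫ r, (B r - c) * g r ∂muI = ∫ r, B r * g r ∂muI - c * I := by
      rw [hI, ← integral_const_mul, ← integral_sub (hBm hg.continuous hgc) (hgi.const_mul c)]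
      congr 1
      funext r
      ring
    rw [e2, ← h1, e1, mul_comm]
  filter_upwards [hz] with r hr
  exact sub_eq_zero.1 hr

/-- A function with an integrable weak derivative has an absolutely continuous representative. -/
lemma exists_absolutelyContinuous_of_weak_deriv {b f : ℝ → ℝ} (hb : Integrable b muI)
    (hf : Integrable f muI)
    (h : ∀ ψ : ℝ → ℝ, ContDiff ℝ ∞ ψ → HasCompactSupport ψ → tsupport ψ ⊆ Ioo 0 1 →
      ∫ r, b r * deriv ψ r ∂muI = -∫ r, f r * ψ r ∂muI) :
    ∃ B : ℝ → ℝ, AbsolutelyContinuousOnInterval B 0 1 ∧ b =ᵐ[muI] B ∧ deriv B =ᵐ[muI] f := by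
  set F : ℝ → ℝ := fun r => ∫ s in (0 : ℝ)..r, f s with hF
  have hfi := intervalIntegrable_of_muI hf
  have hFac : AbsolutelyContinuousOnInterval F 0 1 :=
    hfi.absolutelyContinuousOnInterval_intervalIntegral (by simp)
  have hFd : ∀ᵐ r ∂muI, HasDerivAt F (f r) r := by
    filter_upwards [ae_restrict_of_ae hfi.ae_hasDerivAt_integral,
      ae_restrict_mem measurableSet_Ioo] with r hr hr'
    refine hr ?_ 0 (by simp)
    rw [uIcc_of_le zero_le_one]
    exact Ioo_subset_Icc_self hr'
  have hFi : Integrable F muI := by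
    have := hFac.continuousOn
    rw [uIcc_of_le zero_le_one] at this
    exact this.integrableOn_Icc.mono_set Ioo_subset_Icc_self
  -- The function b and the primitive F both have weak derivative f, so they differ by a constant.
  -- Integration by parts leaves no boundary term because ψ(0) = ψ(1) = 0.
  obtain ⟨c, hc⟩ := exists_const_of_weak_deriv_zero (hb.sub hFi) fun ψ hψ hψc hψs => by
    have hψac : AbsolutelyContinuousOnInterval ψ 0 1 :=
      ((hψ.of_le (by simp)).contDiffOn).absolutelyContinuousOnInterval
    have h0 : ψ 0 = 0 := image_eq_zero_of_notMem_tsupport fun h => lt_irrefl _ (hψs h).1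
    have h1 : ψ 1 = 0 := image_eq_zero_of_notMem_tsupport fun h => lt_irrefl _ (hψs h).2
    have ibp := hFac.integral_mul_deriv_eq_deriv_mul hψac
    rw [h0, h1, mul_zero, mul_zero, sub_zero, zero_sub, ← integral_muI, ← integral_muI] at ibp
    have e1 : ∫ r, deriv F r * ψ r ∂muI = ∫ r, f r * ψ r ∂muI := by
      refine integral_congr_ae ?_
      filter_upwards [hFd] with r hr
      rw [hr.deriv]
    rw [e1, ← h ψ hψ hψc hψs] at ibp
    have hdc : Continuous (deriv ψ) := hψ.continuous_deriv (by simp)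
    obtain ⟨C, hC⟩ := hψc.deriv.exists_bound_of_continuous hdc
    have i1 : Integrable (fun r => b r * deriv ψ r) muI :=
      hb.mul_bdd (c := C) hdc.aestronglyMeasurable (Filter.Eventually.of_forall hC)
    have i2 : Integrable (fun r => F r * deriv ψ r) muI :=
      hFi.mul_bdd (c := C) hdc.aestronglyMeasurable (Filter.Eventually.of_forall hC)
    simp only [Pi.sub_apply, sub_mul]
    rw [integral_sub i1 i2, ibp, sub_self]
  refine ⟨fun r => F r + c, ?_, ?_, ?_⟩
  · exact hFac.fun_add
      ((contDiff_const (c := c)).contDiffOn (n := 1)).absolutelyContinuousOnInterval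
  · filter_upwards [hc] with r hr
    rw [Pi.sub_apply] at hr
    linarith
  · filter_upwards [hFd] with r hr using (hr.add_const c).deriv

/-- If `d' = b` with `d(0) = d(1) = 0` and `b' = m d` on `(0, 1)`, both in the weak sense, then
`b = d = 0`. -/
lemma eq_zero_of_weak_dirichlet {b d : ℝ → ℝ} {m : ℝ} (hm : 0 < m) (hb : MemLp b 2 muI)
    (hd : MemLp d 2 muI)
    (h1 : ∀ h : ℝ → ℝ, ContDiff ℝ ∞ h → ∫ r, (b r * h r + d r * deriv h r) ∂muI = 0)
    (h2 : ∀ ψ : ℝ → ℝ, ContDiff ℝ ∞ ψ → HasCompactSupport ψ → tsupport ψ ⊆ Ioo 0 1 →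
      ∫ r, b r * deriv ψ r ∂muI = -∫ r, m * d r * ψ r ∂muI) :
    b =ᵐ[muI] 0 ∧ d =ᵐ[muI] 0 := by
  have hbi : Integrable b muI := hb.integrable (by norm_num)
  have hdi : Integrable d muI := hd.integrable (by norm_num)
  have hcm : ∀ {u h : ℝ → ℝ}, MemLp u 2 muI → Continuous h → Integrable (fun r => u r * h r) muI :=
    fun hu hh => hu.integrable_mul (memLp_muI_of_continuous hh)
  obtain ⟨B, hBac, hbB, hBd⟩ := exists_absolutelyContinuous_of_weak_deriv hbi (hdi.const_mul m) h2
  obtain ⟨D, hDac, hdD, hDd⟩ := exists_absolutelyContinuous_of_weak_deriv hdi hbi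
    fun ψ hψ _ _ => by
      have := h1 ψ hψ
      rw [integral_add (hcm hb hψ.continuous) (hcm hd (hψ.continuous_deriv (by simp)))] at this
      linarith
  -- Compactly supported h only gave D' = b. Letting h be nonzero at the endpoints encodes the
  -- Dirichlet conditions.
  have hbdry : ∀ h : ℝ → ℝ, ContDiff ℝ ∞ h → D 1 * h 1 - D 0 * h 0 = 0 := by
    intro h hh
    have hac : AbsolutelyContinuousOnInterval h 0 1 :=
      ((hh.of_le (by simp)).contDiffOn).absolutelyContinuousOnInterval
    rw [← hDac.integral_deriv_mul_eq_sub hac, ← integral_muI, ← h1 h hh]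
    refine integral_congr_ae ?_
    filter_upwards [hdD, hDd] with r e1 e2
    rw [e1, e2]
  have hD1 : D 1 = 0 := by simpa using hbdry id contDiff_id
  have hD0 : D 0 = 0 := by simpa [hD1] using hbdry (fun _ => 1) contDiff_const
  -- The energy identity: (DB)' = D'B + DB' = b² + m d² almost everywhere, and DB vanishes at both
  -- ends.
  have hsum : ∫ r, (b r ^ 2 + m * d r ^ 2) ∂muI = 0 := by
    have := hDac.integral_deriv_mul_eq_sub hBac
    rw [hD1, hD0, zero_mul, zero_mul, sub_zero, ← integral_muI] at this
    rw [← this]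
    refine integral_congr_ae ?_
    filter_upwards [hdD, hDd, hbB, hBd] with r e1 e2 e3 e4
    rw [e2, e4, ← e1, ← e3]
    ring
  have hint : Integrable (fun r => b r ^ 2 + m * d r ^ 2) muI :=
    hb.integrable_sq.add (hd.integrable_sq.const_mul m)
  rw [integral_eq_zero_iff_of_nonneg (fun r => by positivity) hint] at hsum
  constructor
  · filter_upwards [hsum] with r hr
    simp only [Pi.zero_apply] at hr ⊢
    nlinarith [sq_nonneg (b r), mul_nonneg hm.le (sq_nonneg (d r))]
  · filter_upwards [hsum] with r hr
    simp only [Pi.zero_apply] at hr ⊢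
    have h3 : m * d r ^ 2 = 0 :=
      le_antisymm (by nlinarith [sq_nonneg (b r)]) (mul_nonneg hm.le (sq_nonneg _))
    simpa [hm.ne'] using h3

/-! ### Fourier coefficients on circles -/

/-- Parseval's identity for real functions. -/
lemma hasSum_sq_fourierCoeff_ofReal {f : Circ → ℝ} (hf : MemLp f 2 volume) :
    HasSum (fun n => ‖fourierCoeff (fun θ => (f θ : ℂ)) n‖ ^ 2)
      ((2 * Real.pi)⁻¹ * ∫ θ, f θ ^ 2) := by
  have h : MemLp (fun θ => (f θ : ℂ)) 2 (AddCircle.haarAddCircle : Measure Circ) :=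
    hf.ofReal.haarAddCircle
  have hs := hasSum_sq_fourierCoeff (h.toLp _)
  rw [fourierCoeff_congr_ae h.coeFn_toLp] at hs
  have e : ∫ t, ‖h.toLp _ t‖ ^ 2 ∂(AddCircle.haarAddCircle : Measure Circ) =
      (2 * Real.pi)⁻¹ * ∫ θ, f θ ^ 2 := by
    refine Eq.trans (integral_congr_ae ?_) AddCircle.integral_haarAddCircle
    filter_upwards [h.coeFn_toLp] with θ hθ
    rw [hθ, Complex.norm_real, Real.norm_eq_abs, sq_abs]
  rwa [e] at hs

/-- The trigonometric moment `r ↦ ∫_𝕋 u(θ, r) Re (w e^{inθ}) dθ`. -/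
noncomputable def moment (u : Cyl → ℝ) (w : ℂ) (n : ℤ) (r : ℝ) : ℝ :=
  ∫ θ : Circ, u (θ, r) * trig w n θ

lemma moment_smul (u : Cyl → ℝ) (c : ℝ) (w : ℂ) (n : ℤ) (r : ℝ) :
    moment u (c * w) n r = c * moment u w n r := by
  unfold moment
  rw [← integral_const_mul]
  congr 1
  funext θ
  rw [trig_smul]
  ring

lemma ae_memLp_slice {u : Cyl → ℝ} (hu : MemLp u 2 muOm) :
    ∀ᵐ r ∂muI, MemLp (fun θ : Circ => u (θ, r)) 2 volume := by
  have hsq := hu.integrable_sq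
  have hm := hu.aestronglyMeasurable
  rw [muOm_eq_prod] at hsq hm
  filter_upwards [hsq.prod_left_ae, hm.prod_swap.prodMk_left] with r h1 h2
  exact (memLp_two_iff_integrable_sq h2).2 h1

lemma integrable_slice_sq {u : Cyl → ℝ} (hu : MemLp u 2 muOm) :
    Integrable (fun r => ∫ θ : Circ, u (θ, r) ^ 2) muI := by
  have hsq := hu.integrable_sq
  rw [muOm_eq_prod] at hsq
  exact hsq.integral_prod_right

lemma memLp_circ_of_continuous {f : Circ → ℝ} (hf : Continuous f) : MemLp f 2 volume := by
  obtain ⟨C, hC⟩ := isCompact_univ.exists_bound_of_continuousOn hf.continuousOn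
  exact MemLp.of_bound hf.aestronglyMeasurable C
    (Filter.Eventually.of_forall fun θ => hC θ (mem_univ θ))

/-- Cauchy–Schwarz on each circle bounds the squared moment by a constant times the square integral
of the slice, which is integrable in r by Fubini. -/
lemma memLp_moment {u : Cyl → ℝ} (hu : MemLp u 2 muOm) (w : ℂ) (n : ℤ) :
    MemLp (moment u w n) 2 muI := by
  have hm : AEStronglyMeasurable (moment u w n) muI := by
    have := hu.aestronglyMeasurable.mul
      ((continuous_trig w n).comp continuous_fst).aestronglyMeasurable (μ := muOm)
    rw [muOm_eq_prod] at this
    exact this.prod_swap.integral_prod_right'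
  rw [memLp_two_iff_integrable_sq hm]
  refine Integrable.mono' ((integrable_slice_sq hu).mul_const (∫ θ, trig w n θ ^ 2)) (hm.pow 2) ?_
  filter_upwards [ae_memLp_slice hu] with r hr
  rw [Real.norm_eq_abs, abs_pow]
  have h := abs_integral_mul_le hr (memLp_circ_of_continuous (continuous_trig w n))
  refine (pow_le_pow_left₀ (abs_nonneg _) h 2).trans ?_
  rw [mul_pow, Real.sq_sqrt (by positivity), Real.sq_sqrt (by positivity)]

lemma integral_mul_tensor {u : Cyl → ℝ} (hu : MemLp u 2 muOm) (w : ℂ) (n : ℤ) {g : ℝ → ℝ}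
    (hg : Continuous g) :
    ∫ z, u z * tensor w n g z ∂muOm = ∫ r, moment u w n r * g r ∂muI := by
  rw [integral_muOm (integrable_mul_of_memLp hu (continuous_tensor w n hg))]
  congr 1
  funext r
  rw [moment, ← integral_mul_const]
  congr 1
  funext θ
  rw [tensor]
  ring

/-- A square-integrable function on `Ω` whose trigonometric moments vanish is zero. -/
lemma ae_eq_zero_of_moment {u : Cyl → ℝ} (hu : MemLp u 2 muOm)
    (h : ∀ w n, moment u w n =ᵐ[muI] 0) : u =ᵐ[muOm] 0 := by
  -- The amplitudes 1 and i give the real part and minus the imaginary part of ∫ u e^{inθ} dθ. There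
  -- are countably many n, so one null set of heights serves for all.
  have h1 : ∀ᵐ r ∂muI, ∀ n, moment u 1 n r = 0 := ae_all_iff.2 fun n => h 1 n
  have h2 : ∀ᵐ r ∂muI, ∀ n, moment u Complex.I n r = 0 := ae_all_iff.2 fun n => h Complex.I n
  have h3 : ∀ᵐ r ∂muI, ∫ θ : Circ, u (θ, r) ^ 2 = 0 := by
    filter_upwards [h1, h2, ae_memLp_slice hu] with r h1 h2 hr
    have hp := hasSum_sq_fourierCoeff_ofReal hr
    have hi : Integrable (fun θ : Circ => (u (θ, r) : ℂ)) volume :=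
      (hr.integrable (by norm_num)).ofReal
    have hc : ∀ n, fourierCoeff (fun θ : Circ => (u (θ, r) : ℂ)) n = 0 := by
      intro n
      have hin : Integrable (fun θ : Circ => (u (θ, r) : ℂ) * fourier (-n) θ) volume :=
        hi.mul_bdd (c := 1) (fourier (-n)).continuous.aestronglyMeasurable
          (Filter.Eventually.of_forall fun θ => by rw [fourier_apply, Circle.norm_coe])
      have h0 : ∫ θ : Circ, (u (θ, r) : ℂ) * fourier (-n) θ = 0 := by
        apply Complex.ext
        · refine (integral_re hin).symm.trans (Eq.trans ?_ (h1 (-n)))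
          unfold moment trig
          congr 1
          funext θ
          simp
        · refine (integral_im hin).symm.trans (Eq.trans ?_ ((neg_eq_zero).2 (h2 (-n))))
          rw [moment, ← integral_neg]
          congr 1
          funext θ
          simp [trig]
      rw [fourierCoeff, AddCircle.integral_haarAddCircle]
      simp only [smul_eq_mul, mul_comm _ ((u (_, r) : ℝ) : ℂ)]
      rw [h0, smul_zero]
    simp only [hc, norm_zero, ne_eq, OfNat.ofNat_ne_zero, not_false_eq_true, zero_pow] at hp
    have := hp.unique hasSum_zero
    exact (mul_eq_zero.1 this).resolve_left (by have := Real.pi_pos; positivity)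
  have h4 : ∫ z, u z ^ 2 ∂muOm = 0 := by
    rw [integral_muOm hu.integrable_sq]
    exact integral_eq_zero_of_ae h3
  rw [integral_eq_zero_iff_of_nonneg (fun z => sq_nonneg _) hu.integrable_sq] at h4
  filter_upwards [h4] with z hz
  simpa using hz

/-! ### Density of smooth fields in `H(div, Ω)` -/

lemma isTest_tensor (w : ℂ) (n : ℤ) {ψ : ℝ → ℝ} (hψ : ContDiff ℝ ∞ ψ) (hc : HasCompactSupport ψ)
    (hs : tsupport ψ ⊆ Ioo 0 1) : IsTest (tensor w n ψ) := by
  have hsub : tsupport (tensor w n ψ) ⊆ univ ×ˢ tsupport ψ := by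
    refine closure_minimal (fun z hz => ⟨mem_univ _, ?_⟩) (isClosed_univ.prod (isClosed_tsupport _))
    by_contra h
    refine hz ?_
    simp [tensor, image_eq_zero_of_notMem_tsupport h]
  refine ⟨isSmooth_tensor w n hψ, ?_, hsub.trans (prod_mono_right hs)⟩
  exact (isCompact_univ.prod hc.isCompact).of_isClosed_subset (isClosed_tsupport _) hsub

/-- A field in `H(div, Ω)` that is orthogonal to all smooth fields vanishes. -/
lemma eq_zero_of_orthogonal_smooth {u₁ u₂ d : Cyl → ℝ} (h₁ : MemLp u₁ 2 muOm)
    (h₂ : MemLp u₂ 2 muOm) (hd : MemLp d 2 muOm) (hw : IsWeakDiv u₁ u₂ d)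
    (ho : ∀ f g, IsSmooth f → IsSmooth g →
      ∫ z, (u₁ z * f z + u₂ z * g z + d z * (pdTheta f z + pdR g z)) ∂muOm = 0) :
    u₁ =ᵐ[muOm] 0 ∧ u₂ =ᵐ[muOm] 0 ∧ d =ᵐ[muOm] 0 := by
  have hcm : ∀ {u h : ℝ → ℝ}, MemLp u 2 muI → Continuous h → Integrable (fun r => u r * h r) muI :=
    fun hu hh => hu.integrable_mul (memLp_muI_of_continuous hh)
  -- Orthogonality says 𝐮 = ∇d with d = 0 on both boundary circles, and d = div 𝐮. In the n-th mode
  -- this reads u₁ = ∂_θ d, u₂ = d', u₂' = (1 + n²) d. The amplitude of u₁ is rotated by i so that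
  -- ∂_θ becomes multiplication by the real number n.
  have key : ∀ w n, moment u₁ (Complex.I * w) n =ᵐ[muI] 0 ∧ moment u₂ w n =ᵐ[muI] 0 ∧
      moment d w n =ᵐ[muI] 0 := by
    intro w n
    have ma := memLp_moment h₁ (Complex.I * w) n
    have mb := memLp_moment h₂ w n
    have md := memLp_moment hd w n
    have hI : Complex.I * n * (Complex.I * w) = ((-n : ℝ) : ℂ) * w := by
      push_cast
      linear_combination (n * w) * Complex.I_mul_I
    have hI' : Complex.I * n * w = ((n : ℝ) : ℂ) * (Complex.I * w) := by
      push_cast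
      ring
    have ha : ∀ᵐ r ∂muI, moment u₁ (Complex.I * w) n r = n * moment d w n r := by
      have hz : (fun r => moment u₁ (Complex.I * w) n r - n * moment d w n r) =ᵐ[muI] 0 := by
        refine ae_eq_zero_of_test ((ma.sub (md.const_mul (n : ℝ))).integrable (by norm_num))
          fun g hg _ _ => ?_
        have h := ho _ _ (isSmooth_tensor (Complex.I * w) n hg) IsSmooth.zero
        rw [pdTheta_tensor, hI] at h
        have e0 : pdR (0 : Cyl → ℝ) = 0 := by
          funext z
          simp [pdR]
        simp only [e0, Pi.zero_apply, mul_zero, add_zero] at h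
        rw [integral_add (integrable_mul_of_memLp h₁ (continuous_tensor _ _ hg.continuous))
          (integrable_mul_of_memLp hd (continuous_tensor _ _ hg.continuous)),
          integral_mul_tensor h₁ _ _ hg.continuous, integral_mul_tensor hd _ _ hg.continuous,
          ← integral_add (hcm ma hg.continuous) (hcm (memLp_moment hd _ _) hg.continuous)] at h
        rw [← h]
        congr 1
        funext r
        rw [moment_smul]
        ring
      filter_upwards [hz] with r hr
      exact sub_eq_zero.1 hr
    obtain ⟨hb0, hd0⟩ := eq_zero_of_weak_dirichlet (b := moment u₂ w n) (d := moment d w n)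
      (m := 1 + (n : ℝ) ^ 2) (by positivity) mb md (fun h hh => by
        have hdc : Continuous (deriv h) := hh.continuous_deriv (by simp)
        have e := ho _ _ IsSmooth.zero (isSmooth_tensor w n hh)
        have e0 : pdTheta (0 : Cyl → ℝ) = 0 := by
          funext z
          simp [pdTheta]
        rw [pdR_tensor w n (hh.differentiable (by simp))] at e
        simp only [e0, Pi.zero_apply, mul_zero, zero_add] at e
        rwa [integral_add (integrable_mul_of_memLp h₂ (continuous_tensor _ _ hh.continuous))
          (integrable_mul_of_memLp hd (continuous_tensor _ _ hdc)),
          integral_mul_tensor h₂ _ _ hh.continuous, integral_mul_tensor hd _ _ hdc,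
          ← integral_add (hcm mb hh.continuous) (hcm md hdc)] at e) fun ψ hψ hc hs => by
        have hdc : Continuous (deriv ψ) := hψ.continuous_deriv (by simp)
        have e := hw _ (isTest_tensor w n hψ hc hs)
        rw [pdTheta_tensor, pdR_tensor w n (hψ.differentiable (by simp)), hI',
          integral_add (integrable_mul_of_memLp h₁ (continuous_tensor _ _ hψ.continuous))
          (integrable_mul_of_memLp h₂ (continuous_tensor _ _ hdc)),
          integral_mul_tensor h₁ _ _ hψ.continuous, integral_mul_tensor h₂ _ _ hdc,
          integral_mul_tensor hd _ _ hψ.continuous] at e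
        -- One factor n comes from ∂_θ of the test function and the other from `ha`; together they
        -- turn m = 1 into m = 1 + n².
        have e1 : ∫ r, moment u₁ (((n : ℝ) : ℂ) * (Complex.I * w)) n r * ψ r ∂muI =
            ∫ r, (n : ℝ) ^ 2 * (moment d w n r * ψ r) ∂muI := by
          refine integral_congr_ae ?_
          filter_upwards [ha] with r hr
          rw [moment_smul, hr]
          ring
        have e2 : ∫ r, (1 + (n : ℝ) ^ 2) * moment d w n r * ψ r ∂muI =
            (1 + (n : ℝ) ^ 2) * ∫ r, moment d w n r * ψ r ∂muI := by
          rw [← integral_const_mul]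
          congr 1
          funext r
          ring
        rw [e1, integral_const_mul] at e
        rw [e2]
        linarith
    refine ⟨?_, hb0, hd0⟩
    filter_upwards [ha, hd0] with r hr hr'
    rw [hr, hr', Pi.zero_apply, mul_zero]
  refine ⟨ae_eq_zero_of_moment h₁ fun w n => ?_, ae_eq_zero_of_moment h₂ fun w n => (key w n).2.1,
    ae_eq_zero_of_moment hd fun w n => (key w n).2.2⟩
  -- The amplitude -iw undoes the rotation by i built into `key`.
  have h := (key (-Complex.I * w) n).1
  have e : Complex.I * (-Complex.I * w) = w := by linear_combination (-w) * Complex.I_mul_I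
  rwa [e] at h

lemma continuous_integral_mul {φ : Cyl → ℝ} (hφ : Continuous φ) :
    Continuous fun u : L2Om => ∫ z, u z * φ z ∂muOm := by
  have h := memLp_of_continuous hφ
  have e : (fun u : L2Om => ∫ z, u z * φ z ∂muOm) = fun u => inner ℝ u (h.toLp φ) := by
    funext u
    rw [← inner_toLp (Lp.memLp u) h, Lp.toLp_coeFn]
  rw [e]
  fun_prop

/-- Each test function imposes one closed linear condition. Closedness makes H(div, Ω) a Hilbert
space, so that density can be read off from the orthogonal complement. -/
lemma isClosed_HdivSub : IsClosed (HdivSub : Set (PiLp 2 (fun _ : Fin 3 => L2Om))) := by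
  have e : (HdivSub : Set (PiLp 2 (fun _ : Fin 3 => L2Om))) = ⋂ φ, ⋂ _ : IsTest φ,
      {U | ∫ z, U 0 z * pdTheta φ z ∂muOm + ∫ z, U 1 z * pdR φ z ∂muOm =
        -∫ z, U 2 z * φ z ∂muOm} := by
    ext U
    simp only [mem_iInter, mem_ofPred_eq]
    refine forall_congr' fun φ => forall_congr' fun hφ => ?_
    rw [integral_add (integrable_mul_of_memLp (Lp.memLp (U 0)) hφ.smooth.pdTheta.continuous)
      (integrable_mul_of_memLp (Lp.memLp (U 1)) hφ.smooth.pdR.continuous)]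
  rw [e]
  have hp : ∀ i : Fin 3, Continuous fun U : PiLp 2 (fun _ : Fin 3 => L2Om) => U i := fun i => by
    fun_prop
  refine isClosed_iInter fun φ => isClosed_iInter fun hφ => isClosed_eq ?_ ?_
  · exact ((continuous_integral_mul hφ.smooth.pdTheta.continuous).comp (hp 0)).add
      ((continuous_integral_mul hφ.smooth.pdR.continuous).comp (hp 1))
  · exact ((continuous_integral_mul hφ.smooth.continuous).comp (hp 2)).neg

lemma inner_Lp_toLp {φ : Cyl → ℝ} (u : L2Om) (h : MemLp φ 2 muOm) :
    inner ℝ (h.toLp φ) u = ∫ z, u z * φ z ∂muOm := by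
  rw [real_inner_comm, ← inner_toLp (Lp.memLp u) h, Lp.toLp_coeFn]

/-- `[C^∞(Ω̄)]²` is dense in `H(div, Ω)`. -/
lemma denseRange_toHdiv : DenseRange SmoothField.toHdiv := by
  have : CompleteSpace HdivSub := isClosed_HdivSub.completeSpace_coe
  let T : SmoothField →ₗ[ℝ] HdivSub := SmoothField.toHdiv
  have hT : (LinearMap.range T).topologicalClosure = ⊤ := by
    rw [Submodule.topologicalClosure_eq_top_iff, Submodule.eq_bot_iff]
    intro U hU
    rw [Submodule.mem_orthogonal] at hU
    have hz := eq_zero_of_orthogonal_smooth (Lp.memLp (U.1 0)) (Lp.memLp (U.1 1))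
      (Lp.memLp (U.1 2)) U.2 fun f g hf hg => by
        have hdiv : Continuous fun z => pdTheta f z + pdR g z :=
          hf.pdTheta.continuous.add hg.pdR.continuous
        have h : inner ℝ (T ⟨(f, g), hf, hg⟩) U = 0 := hU _ ⟨_, rfl⟩
        rw [Submodule.coe_inner, PiLp.inner_apply, Fin.sum_univ_three] at h
        have e0 : inner ℝ ((T ⟨(f, g), hf, hg⟩ : PiLp 2 fun _ : Fin 3 => L2Om) 0) (U.1 0) =
          ∫ z, U.1 0 z * f z ∂muOm := inner_Lp_toLp _ (memLp_of_continuous hf.continuous)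
        have e1 : inner ℝ ((T ⟨(f, g), hf, hg⟩ : PiLp 2 fun _ : Fin 3 => L2Om) 1) (U.1 1) =
          ∫ z, U.1 1 z * g z ∂muOm := inner_Lp_toLp _ (memLp_of_continuous hg.continuous)
        have e2 : inner ℝ ((T ⟨(f, g), hf, hg⟩ : PiLp 2 fun _ : Fin 3 => L2Om) 2) (U.1 2) =
          ∫ z, U.1 2 z * (pdTheta f z + pdR g z) ∂muOm :=
          inner_Lp_toLp _ (memLp_of_continuous hdiv)
        rw [e0, e1, e2] at h
        have i0 := integrable_mul_of_memLp (Lp.memLp (U.1 0)) hf.continuous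
        have i1 := integrable_mul_of_memLp (Lp.memLp (U.1 1)) hg.continuous
        have i2 := integrable_mul_of_memLp (Lp.memLp (U.1 2)) hdiv
        have i01 : Integrable (fun z => U.1 0 z * f z + U.1 1 z * g z) muOm := i0.add i1
        rw [← integral_add i0 i1, ← integral_add i01 i2] at h
        exact h
    apply Subtype.ext
    apply PiLp.ext
    intro i
    fin_cases i
    · exact (Lp.eq_zero_iff_ae_eq_zero).2 hz.1
    · exact (Lp.eq_zero_iff_ae_eq_zero).2 hz.2.1
    · exact (Lp.eq_zero_iff_ae_eq_zero).2 hz.2.2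
  have := (Submodule.dense_iff_topologicalClosure_eq_top).2 hT
  rwa [LinearMap.coe_range] at this

/-! ### Extension of trigonometric polynomials from `Γ*` to `Ω` -/

/-- The sum is the real part of a complex trigonometric polynomial, whose L² norm is computed by
orthonormality. Passing to the real part can only lose. -/
lemma integral_sum_trig_sq_le (s : Finset ℤ) (a : ℤ → ℂ) :
    ∫ θ : Circ, (∑ n ∈ s, trig (a n) n θ) ^ 2 ≤ 2 * Real.pi * ∑ n ∈ s, ‖a n‖ ^ 2 := by
  set F : C(Circ, ℂ) := ∑ n ∈ s, a n • fourier n with hF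
  have hsum : ∀ θ, ∑ n ∈ s, trig (a n) n θ = (F θ).re := by
    intro θ
    simp [hF, trig, ContinuousMap.sum_apply]
  have h1 : inner ℂ (ContinuousMap.toLp 2 AddCircle.haarAddCircle ℂ F)
      (ContinuousMap.toLp 2 AddCircle.haarAddCircle ℂ F) = ((∑ n ∈ s, ‖a n‖ ^ 2 : ℝ) : ℂ) := by
    have e : ContinuousMap.toLp 2 AddCircle.haarAddCircle ℂ F = ∑ n ∈ s, a n • fourierLp 2 n := by
      rw [hF, map_sum]
      simp only [map_smul]
    rw [e, orthonormal_fourier.inner_sum]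
    push_cast
    refine Finset.sum_congr rfl fun n _ => ?_
    rw [mul_comm, Complex.mul_conj, Complex.normSq_eq_norm_sq]
    push_cast
    rfl
  rw [ContinuousMap.inner_toLp] at h1
  have h2 : ∫ θ, ‖F θ‖ ^ 2 ∂AddCircle.haarAddCircle = ∑ n ∈ s, ‖a n‖ ^ 2 := by
    have h3 : ∀ θ, F θ * (starRingEnd ℂ) (F θ) = ((‖F θ‖ ^ 2 : ℝ) : ℂ) := fun θ => by
      rw [Complex.mul_conj, Complex.normSq_eq_norm_sq]
    simp only [h3] at h1
    exact Complex.ofReal_injective ((integral_ofReal (𝕜 := ℂ)).symm.trans h1)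
  rw [← h2, AddCircle.integral_haarAddCircle, smul_eq_mul,
    mul_inv_cancel_left₀ Real.two_pi_pos.ne']
  have hi : ∀ {f : Circ → ℝ}, Continuous f → Integrable f volume := fun hf =>
    (memLp_circ_of_continuous hf).integrable (by norm_num)
  refine integral_mono (hi ?_) (hi (by fun_prop)) fun θ => ?_
  · simp only [hsum]
    fun_prop
  · simp only [hsum]
    rw [← sq_abs (F θ).re]
    exact pow_le_pow_left₀ (abs_nonneg _) (Complex.abs_re_le_norm _) 2

/-- The frequency weight `1 + |n|`. -/
noncomputable def freq (n : ℤ) : ℝ := 1 + |(n : ℝ)|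

lemma one_le_freq (n : ℤ) : 1 ≤ freq n := by
  unfold freq
  linarith [abs_nonneg (n : ℝ)]

lemma freq_pos (n : ℤ) : 0 < freq n := zero_lt_one.trans_le (one_le_freq n)

/-- The decay rate equals the frequency weight m, so integrating m² e^{-2mr} over r gains one factor
1/m. This gain is why the H^{1/2} norm controls the H¹ norm of the extension. -/
lemma integral_exp_sq_le (n : ℤ) :
    ∫ r, (freq n * Real.exp (-freq n * r)) ^ 2 ∂muI ≤ freq n / 2 := by
  set m := freq n with hm
  have hd : ∀ r : ℝ, HasDerivAt (fun s : ℝ => -(m / 2) * Real.exp (-(2 * m) * s))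
      ((m * Real.exp (-m * r)) ^ 2) r := by
    intro r
    have h1 : HasDerivAt (fun s : ℝ => -(2 * m) * s) (-(2 * m)) r := by
      simpa using (hasDerivAt_id r).const_mul (-(2 * m))
    refine (h1.exp.const_mul (-(m / 2))).congr_deriv ?_
    have : Real.exp (-(2 * m) * r) = Real.exp (-m * r) ^ 2 := by
      rw [← Real.exp_nat_mul]
      congr 1
      push_cast
      ring
    rw [this]
    ring
  rw [integral_muI, intervalIntegral.integral_eq_sub_of_hasDerivAt (fun r _ => hd r)
    ((by fun_prop : Continuous fun r : ℝ => (m * Real.exp (-m * r)) ^ 2).intervalIntegrable _ _)]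
  rw [mul_zero, Real.exp_zero]
  have := mul_pos (freq_pos n) (Real.exp_pos (-(2 * m) * 1))
  rw [← hm] at this
  linarith

/-- The modes decouple on each circle by `integral_sum_trig_sq_le`, after which each radial factor
is integrated by `integral_exp_sq_le`. The constant is 2π · 1/2 = π. -/
lemma integral_sum_tensor_sq_le {C : ℝ} (s : Finset ℤ) (c : ℤ → ℂ) (G : ℤ → ℝ → ℝ)
    (hG : ∀ n, Continuous (G n))
    (hb : ∀ n, ∀ r ∈ Ioo (0 : ℝ) 1, |G n r| ≤ C * (freq n * Real.exp (-freq n * r))) :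
    ∫ z, ((∑ n ∈ s, tensor (c n) n (G n)) z) ^ 2 ∂muOm ≤
      Real.pi * C ^ 2 * ∑ n ∈ s, freq n * ‖c n‖ ^ 2 := by
  have hcont : Continuous (∑ n ∈ s, tensor (c n) n (G n)) := by
    rw [Finset.sum_fn]
    exact continuous_finsetSum _ fun n _ => continuous_tensor _ _ (hG n)
  have hE : ∀ n, Integrable (fun r => (freq n * Real.exp (-freq n * r)) ^ 2) muI := fun n =>
    integrable_muI_of_continuous (by fun_prop)
  have hint : Integrable (fun r => ∑ n ∈ s,
      (2 * Real.pi * C ^ 2 * ‖c n‖ ^ 2) * (freq n * Real.exp (-freq n * r)) ^ 2) muI :=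
    integrable_finsetSum _ fun n _ => (hE n).const_mul _
  rw [integral_muOm (memLp_of_continuous hcont).integrable_sq]
  calc ∫ r in Ioo (0 : ℝ) 1, ∫ θ : Circ, ((∑ n ∈ s, tensor (c n) n (G n)) (θ, r)) ^ 2
      ≤ ∫ r, ∑ n ∈ s,
          (2 * Real.pi * C ^ 2 * ‖c n‖ ^ 2) * (freq n * Real.exp (-freq n * r)) ^ 2 ∂muI := by
        refine integral_mono_ae (integrable_slice_sq (memLp_of_continuous hcont)) hint ?_
        filter_upwards [ae_restrict_mem measurableSet_Ioo] with r hr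
        have e : ∀ θ : Circ, (∑ n ∈ s, tensor (c n) n (G n)) (θ, r) =
            ∑ n ∈ s, trig ((G n r : ℂ) * c n) n θ := by
          intro θ
          rw [Finset.sum_apply]
          refine Finset.sum_congr rfl fun n _ => ?_
          rw [trig_smul, tensor, mul_comm]
        simp only [e]
        refine (integral_sum_trig_sq_le s _).trans ?_
        rw [Finset.mul_sum]
        refine Finset.sum_le_sum fun n _ => ?_
        rw [norm_mul, Complex.norm_real, Real.norm_eq_abs, mul_pow]
        have h2 := pow_le_pow_left₀ (abs_nonneg _) (hb n r hr) 2
        rw [mul_pow] at h2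
        have h3 : 0 ≤ 2 * Real.pi * ‖c n‖ ^ 2 := by positivity
        linarith [mul_le_mul_of_nonneg_left h2 h3]
    _ = ∑ n ∈ s, (2 * Real.pi * C ^ 2 * ‖c n‖ ^ 2) *
          ∫ r, (freq n * Real.exp (-freq n * r)) ^ 2 ∂muI := by
        rw [integral_finsetSum _ fun n _ => (hE n).const_mul _]
        exact Finset.sum_congr rfl fun n _ => integral_const_mul _ _
    _ ≤ ∑ n ∈ s, (2 * Real.pi * C ^ 2 * ‖c n‖ ^ 2) * (freq n / 2) := by
        gcongr with n
        exact integral_exp_sq_le n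
    _ = Real.pi * C ^ 2 * ∑ n ∈ s, freq n * ‖c n‖ ^ 2 := by
        rw [Finset.mul_sum]
        refine Finset.sum_congr rfl fun n _ => ?_
        ring

/-- The radial profile used to extend `e^{inθ}` from `Γ*` to `Ω`. -/
noncomputable def profile (n : ℤ) (r : ℝ) : ℝ := upperCut 1 r * Real.exp (-freq n * r)

lemma contDiff_profile (n : ℤ) : ContDiff ℝ ∞ (profile n) :=
  (contDiff_upperCut 1).mul (by fun_prop)

lemma profile_zero (n : ℤ) : profile n 0 = 1 := by
  rw [profile, upperCut_eq_one one_pos (by norm_num), mul_zero, Real.exp_zero, mul_one]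

lemma profile_eq_zero (n : ℤ) {r : ℝ} (hr : 1 / 2 ≤ r) : profile n r = 0 := by
  rw [profile, upperCut_eq_zero one_pos (by linarith), zero_mul]

lemma abs_upperCut_le (δ r : ℝ) : |upperCut δ r| ≤ 1 := by
  rw [upperCut, abs_of_nonneg (Real.smoothTransition.nonneg _)]
  exact Real.smoothTransition.le_one _

lemma abs_profile_le (n : ℤ) (r : ℝ) : |profile n r| ≤ Real.exp (-freq n * r) := by
  rw [profile, abs_mul, abs_of_pos (Real.exp_pos _)]
  exact mul_le_of_le_one_left (Real.exp_pos _).le (abs_upperCut_le _ _)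

/-- In the product rule, the term with the derivative of the cutoff lacks the factor `freq n`. It is
absorbed because `freq n` ≥ 1, and the other term accounts for the 1 in C + 1. -/
lemma exists_profile_bound : ∃ C : ℝ, 1 ≤ C ∧ ∀ n, ∀ r ∈ Ioo (0 : ℝ) 1,
    |deriv (profile n) r| ≤ C * (freq n * Real.exp (-freq n * r)) := by
  have hc : Continuous (deriv (upperCut 1)) := (contDiff_upperCut 1).continuous_deriv (by simp)
  obtain ⟨C, hC⟩ := (isCompact_Icc (a := (0 : ℝ)) (b := 1)).exists_bound_of_continuousOn
    hc.continuousOn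
  have h0 : 0 ≤ C := (norm_nonneg _).trans (hC 0 (by simp))
  refine ⟨C + 1, by linarith, fun n r hr => ?_⟩
  have h1 : HasDerivAt (fun s : ℝ => -freq n * s) (-freq n) r := by
    simpa using (hasDerivAt_id r).const_mul (-freq n)
  have h2 : HasDerivAt (upperCut 1) (deriv (upperCut 1) r) r :=
    ((contDiff_upperCut 1).differentiable (by simp) r).hasDerivAt
  have h3 : deriv (profile n) r = _ := (h2.mul h1.exp).deriv
  rw [h3]
  have hE := Real.exp_pos (-freq n * r)
  have hm := one_le_freq n
  have hCr : |deriv (upperCut 1) r| ≤ C := hC r (Ioo_subset_Icc_self hr)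
  calc |deriv (upperCut 1) r * Real.exp (-freq n * r) +
        upperCut 1 r * (Real.exp (-freq n * r) * -freq n)|
      ≤ |deriv (upperCut 1) r| * Real.exp (-freq n * r) +
        |upperCut 1 r| * (Real.exp (-freq n * r) * freq n) := by
        refine (abs_add_le _ _).trans ?_
        rw [abs_mul, abs_mul, abs_mul, abs_neg, abs_of_pos hE, abs_of_pos (freq_pos n)]
    _ ≤ C * Real.exp (-freq n * r) + 1 * (Real.exp (-freq n * r) * freq n) := by
        have := freq_pos n
        gcongr
        exact abs_upperCut_le _ _
    _ ≤ (C + 1) * (freq n * Real.exp (-freq n * r)) := by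
        nlinarith [mul_nonneg (mul_nonneg h0 hE.le) (sub_nonneg.2 hm)]

/-- The extension to `Ω` of the trigonometric polynomial `Re ∑_{n ∈ s} cₙ e^{inθ}`. -/
noncomputable def extension (c : ℤ → ℂ) (s : Finset ℤ) : Cyl → ℝ :=
  ∑ n ∈ s, tensor (c n) n (profile n)

lemma isSmooth_extension (c : ℤ → ℂ) (s : Finset ℤ) : IsSmooth (extension c s) :=
  IsSmooth.sum fun n _ => isSmooth_tensor _ _ (contDiff_profile n)

lemma extension_eq_zero (c : ℤ → ℂ) (s : Finset ℤ) (θ : Circ) {r : ℝ} (hr : 1 / 2 ≤ r) :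
    extension c s (θ, r) = 0 := by
  rw [extension, Finset.sum_apply]
  exact Finset.sum_eq_zero fun n _ => by simp [tensor, profile_eq_zero n hr]

lemma isSmoothGamma_extension (c : ℤ → ℂ) (s : Finset ℤ) : IsSmoothGamma (extension c s) :=
  ⟨isSmooth_extension c s, 1 / 2, by norm_num, fun θ r _ hr =>
    extension_eq_zero c s θ (by linarith)⟩

lemma extension_zero_right (c : ℤ → ℂ) (s : Finset ℤ) (θ : Circ) :
    extension c s (θ, 0) = ∑ n ∈ s, trig (c n) n θ := by
  rw [extension, Finset.sum_apply]
  exact Finset.sum_congr rfl fun n _ => by simp [tensor, profile_zero]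

/-- The extension is bounded from `H^{1/2}(Γ*)` to `H¹(Ω)`. -/
lemma exists_extension_bound : ∃ K : ℝ, 0 ≤ K ∧ ∀ (c : ℤ → ℂ) (s : Finset ℤ),
    ∫ z, extension c s z ^ 2 ∂muOm ≤ K * ∑ n ∈ s, freq n * ‖c n‖ ^ 2 ∧
    ∫ z, pdTheta (extension c s) z ^ 2 ∂muOm ≤ K * ∑ n ∈ s, freq n * ‖c n‖ ^ 2 ∧
    ∫ z, pdR (extension c s) z ^ 2 ∂muOm ≤ K * ∑ n ∈ s, freq n * ‖c n‖ ^ 2 := by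
  obtain ⟨C, hC1, hC⟩ := exists_profile_bound
  have hC0 : 0 ≤ C := zero_le_one.trans hC1
  have hsm : ∀ (c : ℤ → ℂ) (n : ℤ), IsSmooth (tensor (c n) n (profile n)) := fun c n =>
    isSmooth_tensor _ _ (contDiff_profile n)
  -- One constant serves all three integrals, since the profile, n times the profile, and its
  -- derivative are all dominated by C (1+|n|) e^{-(1+|n|)r}.
  refine ⟨Real.pi * C ^ 2, by have := Real.pi_pos; positivity, fun c s => ⟨?_, ?_, ?_⟩⟩
  · refine integral_sum_tensor_sq_le s c _ (fun n => (contDiff_profile n).continuous)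
      fun n r hr => (abs_profile_le n r).trans ?_
    rw [← mul_assoc]
    exact le_mul_of_one_le_left (Real.exp_pos _).le (one_le_mul_of_one_le_of_one_le hC1
      (one_le_freq n))
  · have e : pdTheta (extension c s) =
        ∑ n ∈ s, tensor (Complex.I * c n) n (fun r => n * profile n r) := by
      rw [extension, pdTheta_sum fun n _ => hsm c n]
      refine Finset.sum_congr rfl fun n _ => ?_
      rw [pdTheta_tensor]
      funext z
      have : Complex.I * n * c n = ((n : ℝ) : ℂ) * (Complex.I * c n) := by
        push_cast
        ring
      rw [tensor, tensor, this, trig_smul]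
      ring
    rw [e]
    refine (integral_sum_tensor_sq_le (C := C) s (fun n => Complex.I * c n) (fun n r => n * profile n r)
      (fun n => continuous_const.mul (contDiff_profile n).continuous) fun n r hr => ?_).trans ?_
    · rw [abs_mul]
      have h1 : |(n : ℝ)| ≤ freq n := by
        unfold freq
        linarith
      calc |(n : ℝ)| * |profile n r| ≤ freq n * Real.exp (-freq n * r) := by
            have := freq_pos n
            gcongr
            exact abs_profile_le n r
        _ ≤ C * (freq n * Real.exp (-freq n * r)) :=
            le_mul_of_one_le_left (mul_pos (freq_pos n) (Real.exp_pos _)).le hC1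
    · simp
  · rw [extension, pdR_sum fun n _ => hsm c n]
    simp only [pdR_tensor _ _ ((contDiff_profile _).differentiable (by simp))]
    exact integral_sum_tensor_sq_le s c _
      (fun n => (contDiff_profile n).continuous_deriv (by simp)) hC

/-! ### Fourier series of traces -/

lemma re_inner_haar {g : Circ → ℝ} {G F : Lp ℂ 2 (AddCircle.haarAddCircle : Measure Circ)}
    {f : Circ → ℂ} (hG : G =ᵐ[AddCircle.haarAddCircle] fun θ => (g θ : ℂ))
    (hF : F =ᵐ[AddCircle.haarAddCircle] f) :
    (inner ℂ G F).re = (2 * Real.pi)⁻¹ * ∫ θ, g θ * (f θ).re := by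
  rw [L2.inner_def]
  refine (integral_re (L2.integrable_inner (𝕜 := ℂ) G F)).symm.trans ?_
  refine Eq.trans (integral_congr_ae ?_) AddCircle.integral_haarAddCircle
  filter_upwards [hG, hF] with θ h1 h2
  rw [h1, h2]
  simp [mul_comm]

/-- The Fourier series of v converges to v in L², so it may be paired term by term with g. Real
parts are then taken, and the factor 2π passes from normalized Haar measure to arc length. -/
lemma hasSum_integral_mul_trig {g : Circ → ℝ} (hg : Continuous g) (v : L2Circ) :
    HasSum (fun n => ∫ θ, g θ * trig (fcoeff v n) n θ) (∫ θ, g θ * v θ) := by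
  have hg' : MemLp (fun θ => (g θ : ℂ)) 2 (AddCircle.haarAddCircle : Measure Circ) :=
    (memLp_circ_of_continuous hg).ofReal.haarAddCircle
  have hv : MemLp (fun θ => ((v θ : ℝ) : ℂ)) 2 (AddCircle.haarAddCircle : Measure Circ) :=
    (Lp.memLp v).ofReal.haarAddCircle
  have h := hasSum_fourier_series_L2 (hv.toLp _)
  rw [fourierCoeff_congr_ae hv.coeFn_toLp] at h
  have h2 := (Complex.reCLM.hasSum ((innerSL ℂ (hg'.toLp _)).hasSum h)).mul_left (2 * Real.pi)
  have hp : (2 * Real.pi) ≠ 0 := Real.two_pi_pos.ne'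
  have e1 : 2 * Real.pi * Complex.reCLM (innerSL ℂ (hg'.toLp _) (hv.toLp _)) =
      ∫ θ, g θ * v θ := by
    rw [innerSL_apply_apply, Complex.reCLM_apply, re_inner_haar hg'.coeFn_toLp hv.coeFn_toLp,
      mul_inv_cancel_left₀ hp]
    simp
  rw [e1] at h2
  refine h2.congr_fun fun n => ?_
  have hF : (fcoeff v n • fourierLp 2 n : Lp ℂ 2 (AddCircle.haarAddCircle : Measure Circ))
      =ᵐ[AddCircle.haarAddCircle] fun θ => fcoeff v n * fourier n θ := by
    filter_upwards [Lp.coeFn_smul (fcoeff v n)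
      (fourierLp 2 n : Lp ℂ 2 (AddCircle.haarAddCircle : Measure Circ)),
      coeFn_fourierLp (T := 2 * Real.pi) 2 n] with θ h1 h2
    rw [h1, Pi.smul_apply, h2, smul_eq_mul]
  have e2 := re_inner_haar hg'.coeFn_toLp hF
  change ∫ θ, g θ * trig (fcoeff v n) n θ = 2 * Real.pi * (inner ℂ (hg'.toLp _)
    (fcoeff v n • fourierLp 2 n : Lp ℂ 2 (AddCircle.haarAddCircle : Measure Circ))).re
  rw [e2, mul_inv_cancel_left₀ hp]
  rfl

/-- The summand 1 of the weight gives Parseval's sum and |n| gives the second component of v. Only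
an inequality holds because Parseval carries the factor 1/(2π) ≤ 1. -/
lemma exists_hasSum_freq (v : Hhalf) :
    ∃ Q, HasSum (fun n => freq n * ‖fcoeff (Hhalf.toL2 v) n‖ ^ 2) Q ∧ Q ≤ ‖v‖ ^ 2 := by
  have h1 := hasSum_sq_fourierCoeff_ofReal (Lp.memLp (Hhalf.toL2 v))
  have h2 : HasSum (fun n => ‖v.1.snd n‖ ^ 2) (‖v.1.snd‖ ^ 2) := by
    apply_mod_cast lp.hasSum_norm ?_ v.1.snd
    simp
  refine ⟨_, (h1.add h2).congr_fun fun n => ?_, ?_⟩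
  · have h3 : v.1.snd n = ((Real.sqrt |(n : ℝ)| : ℝ) : ℂ) * fcoeff (Hhalf.toL2 v) n := v.2 n
    rw [h3, norm_mul, Complex.norm_real, Real.norm_eq_abs, abs_of_nonneg (Real.sqrt_nonneg _),
      mul_pow, Real.sq_sqrt (abs_nonneg _), freq, add_mul, one_mul]
    rfl
  · have h4 : ‖v‖ ^ 2 = ‖v.1.fst‖ ^ 2 + ‖v.1.snd‖ ^ 2 := WithLp.prod_norm_sq_eq_of_L2 v.1
    rw [h4, ← norm_Lp_sq]
    have h5 : Hhalf.toL2 v = v.1.fst := rfl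
    rw [h5]
    have h6 : (2 * Real.pi)⁻¹ ≤ 1 := inv_le_one_of_one_le₀ (by linarith [Real.pi_gt_three])
    linarith [mul_le_of_le_one_left (sq_nonneg ‖v.1.fst‖) h6]

/-! ### Green's formula and the normal trace -/

lemma integral_pdR_eq {f : Cyl → ℝ} (hf : IsSmooth f) (h1 : ∀ θ, f (θ, 1) = 0) :
    ∫ z, pdR f z ∂muOm = -∫ θ : Circ, f (θ, 0) := by
  rw [integral_muOm' (integrable_of_continuous hf.pdR.continuous), ← integral_neg]
  congr 1
  funext θ
  rw [integral_muI, intervalIntegral.integral_eq_sub_of_hasDerivAt (f := fun s : ℝ => f (θ, s)),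
    h1 θ, zero_sub]
  · exact fun t _ => hf.hasDerivAt_r θ t
  · have : Continuous fun t : ℝ => pdR f (θ, t) := hf.pdR.continuous.comp (by fun_prop)
    exact this.intervalIntegrable _ _

/-- The volume terms `∫_Ω (𝐮 · ∇φ + (div 𝐮) φ) dz` of Green's formula. -/
noncomputable def pairing (U : Hdiv) (φ : Cyl → ℝ) : ℝ :=
  ∫ z, U.1 0 z * pdTheta φ z ∂muOm + ∫ z, U.1 1 z * pdR φ z ∂muOm + ∫ z, U.1 2 z * φ z ∂muOm

lemma continuous_pairing {φ : Cyl → ℝ} (hφ : IsSmooth φ) : Continuous fun U => pairing U φ := by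
  have hp : ∀ i : Fin 3, Continuous fun U : HdivSub => U.1 i := fun i => by
    fun_prop
  exact (((continuous_integral_mul hφ.pdTheta.continuous).comp (hp 0)).add
    ((continuous_integral_mul hφ.pdR.continuous).comp (hp 1))).add
    ((continuous_integral_mul hφ.continuous).comp (hp 2))

lemma sqrt_integral_component_sq_le (U : Hdiv) (i : Fin 3) :
    √(∫ z, U.1 i z ^ 2 ∂muOm) ≤ ‖U‖ := by
  rw [← norm_Lp_sq, Real.sqrt_sq (norm_nonneg _)]
  exact PiLp.norm_apply_le U.1 i

lemma abs_pairing_le (U : Hdiv) {φ : Cyl → ℝ} (hφ : IsSmooth φ) {M : ℝ}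
    (h0 : ∫ z, φ z ^ 2 ∂muOm ≤ M) (hT : ∫ z, pdTheta φ z ^ 2 ∂muOm ≤ M)
    (hR : ∫ z, pdR φ z ^ 2 ∂muOm ≤ M) : |pairing U φ| ≤ 3 * (‖U‖ * √M) := by
  have key : ∀ (i : Fin 3) {f : Cyl → ℝ}, Continuous f → ∫ z, f z ^ 2 ∂muOm ≤ M →
      |∫ z, U.1 i z * f z ∂muOm| ≤ ‖U‖ * √M := fun i f hf hM =>
    (abs_integral_mul_le (Lp.memLp (U.1 i)) (memLp_of_continuous hf)).trans
      (mul_le_mul (sqrt_integral_component_sq_le U i) (Real.sqrt_le_sqrt hM) (Real.sqrt_nonneg _)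
        (norm_nonneg _))
  refine (abs_add_three _ _ _).trans ?_
  linarith [key 0 hφ.pdTheta.continuous hT, key 1 hφ.pdR.continuous hR, key 2 hφ.continuous h0]

/-- The divergence theorem for φ𝐮. The θ-derivative integrates to zero by periodicity, and since φ =
0 on Γ only Γ* contributes. -/
lemma pairing_toHdiv (U : SmoothField) {φ : Cyl → ℝ} (hφ : IsSmooth φ)
    (h1 : ∀ θ, φ (θ, 1) = 0) :
    pairing (SmoothField.toHdiv U) φ = -∫ θ : Circ, U.1.2 (θ, 0) * φ (θ, 0) := by
  obtain ⟨⟨f, g⟩, hf, hg⟩ := U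
  change IsSmooth f at hf
  change IsSmooth g at hg
  have hdiv : Continuous fun z => pdTheta f z + pdR g z :=
    hf.pdTheta.continuous.add hg.pdR.continuous
  have e0 : ∫ z, (SmoothField.toHdiv ⟨(f, g), hf, hg⟩).1 0 z * pdTheta φ z ∂muOm =
      ∫ z, f z * pdTheta φ z ∂muOm := by
    refine integral_congr_ae ?_
    filter_upwards [(memLp_of_continuous hf.continuous).coeFn_toLp] with z hz
    exact congrArg (· * _) hz
  have e1 : ∫ z, (SmoothField.toHdiv ⟨(f, g), hf, hg⟩).1 1 z * pdR φ z ∂muOm =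
      ∫ z, g z * pdR φ z ∂muOm := by
    refine integral_congr_ae ?_
    filter_upwards [(memLp_of_continuous hg.continuous).coeFn_toLp] with z hz
    exact congrArg (· * _) hz
  have e2 : ∫ z, (SmoothField.toHdiv ⟨(f, g), hf, hg⟩).1 2 z * φ z ∂muOm =
      ∫ z, (pdTheta f z + pdR g z) * φ z ∂muOm := by
    refine integral_congr_ae ?_
    filter_upwards [(memLp_of_continuous hdiv).coeFn_toLp] with z hz
    exact congrArg (· * _) hz
  have hT := integral_pdTheta (hf.mul hφ)
  have hR := integral_pdR_eq (hg.mul hφ) fun θ => by simp [h1 θ]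
  rw [pdTheta_mul hf hφ] at hT
  rw [pdR_mul hg hφ] at hR
  simp only [Pi.add_apply, Pi.mul_apply] at hT hR
  have hmul : ∀ {a b : Cyl → ℝ}, Continuous a → Continuous b →
      Integrable (fun z => a z * b z) muOm := fun ha hb => integrable_of_continuous (ha.mul hb)
  have i1 := hmul hf.pdTheta.continuous hφ.continuous
  have i2 := hmul hf.continuous hφ.pdTheta.continuous
  have i3 := hmul hg.pdR.continuous hφ.continuous
  have i4 := hmul hg.continuous hφ.pdR.continuous
  have e3 : ∫ z, (pdTheta f z + pdR g z) * φ z ∂muOm =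
      ∫ z, pdTheta f z * φ z ∂muOm + ∫ z, pdR g z * φ z ∂muOm := by
    rw [← integral_add i1 i3]
    simp only [add_mul]
  rw [integral_add i1 i2] at hT
  rw [integral_add i3 i4] at hR
  rw [pairing, e0, e1, e2, e3]
  linarith

/-! ### The normal trace as a limit of Green pairings. -/

lemma smooth_normalTrace_apply (U : SmoothField) (v : Hhalf) :
    SmoothField.normalTrace U v = -∫ θ : Circ, U.1.2 (θ, 0) * Hhalf.toL2 v θ := by
  have h : SmoothField.normalTrace U v =
      inner ℝ (-(memLp_trace U.2.2).toLp _) (Hhalf.toL2 v) := rfl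
  rw [h, inner_neg_left]
  congr 1
  rw [L2.inner_def]
  refine integral_congr_ae ?_
  filter_upwards [(memLp_trace U.2.2).coeFn_toLp] with θ hθ
  rw [hθ]
  simp [mul_comm]

lemma hasSum_normalTrace (U : SmoothField) (v : Hhalf) :
    HasSum (fun n => -∫ θ : Circ, U.1.2 (θ, 0) * trig (fcoeff (Hhalf.toL2 v) n) n θ)
      (SmoothField.normalTrace U v) := by
  rw [smooth_normalTrace_apply]
  have hc : Continuous fun θ : Circ => U.1.2 (θ, 0) := U.2.2.continuous.comp (by fun_prop)
  exact (hasSum_integral_mul_trig hc _).neg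

lemma pairing_extension (U : SmoothField) (c : ℤ → ℂ) (s : Finset ℤ) :
    pairing (SmoothField.toHdiv U) (extension c s) =
      ∑ n ∈ s, -∫ θ : Circ, U.1.2 (θ, 0) * trig (c n) n θ := by
  have hc : Continuous fun θ : Circ => U.1.2 (θ, 0) := U.2.2.continuous.comp (by fun_prop)
  rw [pairing_toHdiv U (isSmooth_extension c s) fun θ => extension_eq_zero c s θ (by norm_num),
    Finset.sum_neg_distrib, ← integral_finsetSum]
  · simp only [extension_zero_right, Finset.mul_sum]
  · exact fun n _ => (memLp_circ_of_continuous (hc.mul (continuous_trig _ _))).integrable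
      (by norm_num)

/-- For smooth fields, the normal trace tested against `v` is approximated by Green's formula with
the extension of a partial Fourier sum of `v`, with an error controlled by the tail of the
`H^{1/2}` norm of `v`. -/
lemma exists_trace_sub_pairing_bound : ∃ K : ℝ, 0 ≤ K ∧ ∀ (U : SmoothField) (v : Hhalf) (Q : ℝ),
    HasSum (fun n => freq n * ‖fcoeff (Hhalf.toL2 v) n‖ ^ 2) Q → ∀ s : Finset ℤ,
    |SmoothField.normalTrace U v -
        pairing (SmoothField.toHdiv U) (extension (fcoeff (Hhalf.toL2 v)) s)| ≤
      K * ‖SmoothField.toHdiv U‖ * √(Q - ∑ n ∈ s, freq n * ‖fcoeff (Hhalf.toL2 v) n‖ ^ 2) := by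
  obtain ⟨K, hK0, hK⟩ := exists_extension_bound
  refine ⟨3 * √K, by positivity, fun U v Q hQ s => ?_⟩
  set c := fcoeff (Hhalf.toL2 v) with hc
  have ht := (hasSum_normalTrace U v).sub_const (pairing (SmoothField.toHdiv U) (extension c s))
  refine le_of_tendsto ht.abs ?_
  filter_upwards [Filter.eventually_ge_atTop s] with t hst
  -- The partial sum of the trace over t ⊇ s, minus the pairing over s, is the pairing with the
  -- extension over t \ s. The extension bound then involves only frequencies outside s.
  rw [pairing_extension, ← Finset.sum_sdiff hst, add_sub_cancel_right, ← pairing_extension]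
  obtain ⟨h0, hT, hR⟩ := hK c (t \ s)
  refine (abs_pairing_le _ (isSmooth_extension c (t \ s)) h0 hT hR).trans ?_
  have hle : ∑ n ∈ t \ s, freq n * ‖c n‖ ^ 2 ≤ Q - ∑ n ∈ s, freq n * ‖c n‖ ^ 2 := by
    have h1 := Finset.sum_sdiff (f := fun n => freq n * ‖c n‖ ^ 2) hst
    have h2 := sum_le_hasSum t (fun n _ => mul_nonneg (freq_pos n).le (sq_nonneg ‖c n‖)) hQ
    linarith
  rw [Real.sqrt_mul hK0]
  have := Real.sqrt_le_sqrt hle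
  calc 3 * (‖SmoothField.toHdiv U‖ * (√K * √(∑ n ∈ t \ s, freq n * ‖c n‖ ^ 2)))
      = 3 * √K * ‖SmoothField.toHdiv U‖ * √(∑ n ∈ t \ s, freq n * ‖c n‖ ^ 2) := by ring
    _ ≤ _ := by gcongr

/-- The case s = ∅ of the preceding estimate: the tail is then the whole sum, which ‖v‖² dominates.
-/
lemma exists_normalTrace_bound :
    ∃ C, ∀ U : SmoothField, ‖SmoothField.normalTrace U‖ ≤ C * ‖SmoothField.toHdiv U‖ := by
  obtain ⟨K, hK0, hK⟩ := exists_trace_sub_pairing_bound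
  refine ⟨K, fun U => ContinuousLinearMap.opNorm_le_bound _ (by positivity) fun v => ?_⟩
  obtain ⟨Q, hQ, hQv⟩ := exists_hasSum_freq v
  have h := hK U v Q hQ ∅
  rw [pairing_extension, Finset.sum_empty, Finset.sum_empty, sub_zero, sub_zero] at h
  refine h.trans ?_
  gcongr
  exact (Real.sqrt_le_sqrt hQv).trans_eq (Real.sqrt_sq (norm_nonneg _))

/-- Density of the smooth fields and the norm bound are the two hypotheses under which
`extendOfNorm` really extends the given map. -/
lemma normalTrace_toHdiv (U : SmoothField) :
    normalTrace (SmoothField.toHdiv U) = SmoothField.normalTrace U :=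
  LinearMap.extendOfNorm_eq denseRange_toHdiv exists_normalTrace_bound U

lemma isNormalTrace_normalTrace : IsNormalTrace normalTrace := fun U v => by
  rw [normalTrace_toHdiv, smooth_normalTrace_apply]

lemma IsNormalTrace.eq_normalTrace {γ : Hdiv →L[ℝ] HminusHalf} (hγ : IsNormalTrace γ) :
    γ = normalTrace := by
  refine ContinuousLinearMap.ext fun U => congrFun
    (denseRange_toHdiv.equalizer γ.continuous normalTrace.continuous ?_) U
  funext U
  refine ContinuousLinearMap.ext fun v => ?_
  exact (hγ U v).trans (isNormalTrace_normalTrace U v).symm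

/-- Fields in `H(div, Ω; w⁻¹)` have vanishing normal trace on `Γ*`. -/
lemma normalTrace_eq_zero_of_mem_HdivW {α : ℝ} (hα : 1 ≤ α) {U : Hdiv} (hU : U ∈ HdivW α) :
    normalTrace U = 0 := by
  obtain ⟨K, hK0, hK⟩ := exists_trace_sub_pairing_bound
  refine ContinuousLinearMap.ext fun v => ?_
  obtain ⟨Q, hQ, -⟩ := exists_hasSum_freq v
  set c := fcoeff (Hhalf.toL2 v) with hc
  have hbound : ∀ s : Finset ℤ, |normalTrace U v| ≤
      K * ‖U‖ * √(Q - ∑ n ∈ s, freq n * ‖c n‖ ^ 2) := by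
    intro s
    -- For fixed v and s both sides are continuous in V, so the inequality passes from smooth fields
    -- to all of H(div, Ω) by density.
    have hall : ∀ V : Hdiv, |normalTrace V v - pairing V (extension c s)| ≤
        K * ‖V‖ * √(Q - ∑ n ∈ s, freq n * ‖c n‖ ^ 2) := by
      intro V
      refine denseRange_toHdiv.induction_on V (isClosed_le ?_ ?_) fun V => ?_
      · exact (((ContinuousLinearMap.apply ℝ ℝ v).continuous.comp normalTrace.continuous).sub
          (continuous_pairing (isSmooth_extension c s))).abs
      · exact (continuous_const.mul continuous_norm).mul continuous_const
      · rw [normalTrace_toHdiv]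
        exact hK V v Q hQ s
    have hsm := isSmooth_extension c s
    have i0 := integrable_mul_of_memLp (Lp.memLp (U.1 0)) hsm.pdTheta.continuous
    have i1 := integrable_mul_of_memLp (Lp.memLp (U.1 1)) hsm.pdR.continuous
    have i2 := integrable_mul_of_memLp (Lp.memLp (U.1 2)) hsm.continuous
    have i01 : Integrable (fun z => U.1 0 z * pdTheta (extension c s) z +
        U.1 1 z * pdR (extension c s) z) muOm := i0.add i1
    -- Extensions vanish near Γ but not on Γ*; finiteness of the weighted energy is what removes the
    -- boundary term. Only the tail remains in the bound, and it tends to 0 as s grows.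
    have hz : pairing U (extension c s) = 0 := by
      rw [pairing, ← integral_add i0 i1, ← integral_add i01 i2]
      exact weighted_green hα (Lp.memLp (U.1 0)) (Lp.memLp (U.1 1)) (Lp.memLp (U.1 2)) U.2
        (memLp_weighted (Lp.memLp (U.1 1)).aestronglyMeasurable hU) (isSmoothGamma_extension c s)
    have := hall U
    rwa [hz, sub_zero] at this
  have hlim : Filter.Tendsto (fun s : Finset ℤ =>
      K * ‖U‖ * √(Q - ∑ n ∈ s, freq n * ‖c n‖ ^ 2)) Filter.atTop (nhds 0) := by
    have h1 : Filter.Tendsto (fun s : Finset ℤ => Q - ∑ n ∈ s, freq n * ‖c n‖ ^ 2)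
        Filter.atTop (nhds (Q - Q)) := Filter.Tendsto.const_sub Q hQ
    have h2 := ((Real.continuous_sqrt.tendsto _).comp h1).const_mul (K * ‖U‖)
    rwa [sub_self, Real.sqrt_zero, mul_zero] at h2
  exact abs_nonpos_iff.1 (ge_of_tendsto hlim (Filter.Eventually.of_forall hbound))

/-- The weights combine as r^{-α} (r^α ∂_r u)² = r^α (∂_r u)², so the weighted energy of A∇u is the
Dirichlet energy of u. -/
lemma H2w.flux_mem_HdivW {α : ℝ} (hα : 0 ≤ α) (u : H2w α) : u.flux hα ∈ HdivW α := by
  have h1 := u.memLp_dtheta.integrable_sq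
  have h2 := u.memLp_dr.integrable_sq
  refine lt_of_eq_of_lt (lintegral_congr_ae ?_) (h1.add h2).lintegral_lt_top
  filter_upwards [u.memLp_dtheta.coeFn_toLp, (memLp_flux hα u.toH1w).coeFn_toLp, ae_mem_Om]
    with z e0 e1 hz
  have f0 : (u.flux hα).1 0 z = u.dtheta z := e0
  have f1 : (u.flux hα).1 1 z = z.2 ^ α * u.dr z := e1
  have hp : 0 < z.2 ^ α := Real.rpow_pos_of_pos hz.2.1 _
  rw [f0, f1, Pi.add_apply, Real.rpow_neg hz.2.1.le, mul_pow (z.2 ^ (α / 2)),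
    pow_two (z.2 ^ (α / 2)), rpow_half_mul_self (α := α) hz.2.1]
  congr 2
  field_simp

end Cylinder

theorem theorem2p17 (α : ℝ) (hα : 1 ≤ α) (hα' : α < 2) :
    (Cylinder.IsNormalTrace Cylinder.normalTrace ∧
      ∀ γ, Cylinder.IsNormalTrace γ → γ = Cylinder.normalTrace) ∧
    (Cylinder.HdivW α ⊆ {U | Cylinder.normalTrace U = 0}) ∧
    (∀ u : Cylinder.H2w α, u.conormal (zero_le_one.trans hα) = 0) ∧
    (∀ u : Cylinder.H2w α, ∀ v ∈ Cylinder.H1wGamma α,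
      -∫ z, u.divA z * v.val z ∂Cylinder.muOm =
        ∫ z, (v.dtheta z * u.dtheta z + v.dr z * (z.2 ^ α * u.dr z)) ∂Cylinder.muOm) :=
  ⟨⟨Cylinder.isNormalTrace_normalTrace, fun _ hγ => hγ.eq_normalTrace⟩,
    fun _ hU => Cylinder.normalTrace_eq_zero_of_mem_HdivW hα hU,
    fun u => Cylinder.normalTrace_eq_zero_of_mem_HdivW hα (u.flux_mem_HdivW _),
    fun u _ hv => u.green hα hv⟩
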